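/- Let $L$ be a first-order alphabet with at least one constant and a denumerable set of variables. A query is a formula built from $\mathrm{TRUE}$, $\mathrm{FALSE}$, equations and atoms using $\wedge$ and $\exists$; $|Q|$ is the number of atoms occurring in $Q$. A pre-interpretation $J$ is a non-empty domain with an interpretation of the function symbols of $L$; $=$ is identity. An interpretation based on $J$ is a set of generalized atoms $p(d_1,\dots,d_n)$ with $d_i$ in the domain of $J$; a multiinterpretation $\overline I$ for $Q$ is a sequence of $|Q|$ of them. The solution set $\mathrm{Sol}_J(Q,\overline I)$ is the set of valuations over $J$ that satisfy $Q$ when its $j$-th atom (from left to right) is evaluated in the $j$-th component of $\overline I$. Write $Q\preceq_J Q'$ (respectively $Q\approx_J Q'$) if $|Q|=|Q'|$ and $\mathrm{Sol}_J(Q,\overline I)\subseteq \mathrm{Sol}_J(Q',\overline I)$ (respectively $=$) for all multiinterpretations $\overline I$ for $Q$ based on $J$. The free equality axioms $\mathrm{FEA}(L)$ are: $f(x_1,\dots,x_n)=f(y_1,\dots,y_n)\leftrightarrow x_1=y_1\wedge\dots\wedge x_n=y_n$ for each $n$-ary function symbol $f$; $f(x_1,\dots,x_n)=g(y_1,\dots,y_m)\leftrightarrow\mathrm{FALSE}$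 for distinct function symbols $f,g$ (constants included); $x=t\leftrightarrow\mathrm{FALSE}$ whenever the variable $x$ occurs in the term $t$ and $t\not\equiv x$. Write $Q\preceq Q'$ if $Q\preceq_J Q'$ for every pre-interpretation $J$ that is a model of $\mathrm{FEA}(L)$, and $Q\approx Q'$ ($Q$ and $Q'$ are equivalent) if $Q\preceq Q'$ and $Q'\preceq Q$. A model of $\mathrm{FEA}(L)$ is non-trivial if its domain has at least two elements. A query is in solved form if it is $\mathrm{TRUE}$ or $\mathrm{FALSE}$, or has the form $(\exists z_1)\dots(\exists z_k)(x_1=s_1\wedge\dots\wedge x_n=s_n\wedge A_1\wedge\dots\wedge A_m)$ (the bracketing of the conjunction is immaterial), where the variables $x_i$ and $z_j$ are all distinct, no $x_i$ occurs in any $s_j$ or $A_j$, every $z_j$ occurs in the conjunction, and $z_j\not\equiv s_i$ for all $i,j$. A query $Q'$ is isomorphic to a query $Q$ in solved form if it is obtained from $Q$ by finitely many steps of the following types: (a) permuting the equations and permuting the quantifiers $\exists z_j$ (the order of the atoms is kept); (b) renaming bound variables, i.e. replacing a part $(\exists x)G$ by $(\exists y)G_x[y]$, where $y$ is not free in $G$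 and is substitutible for $x$ in $G$; (c) redirecting equations, i.e. simultaneously exchanging $u_i$ and $v_i$ for $i=1,\dots,k$ in the whole query, where $u_1=v_1,\dots,u_k=v_k$ are equations of the query between variables and $u_1,\dots,u_k,v_1,\dots,v_k$ are distinct. **Theorem.** If $J$ is a non-trivial model of $\mathrm{FEA}(L)$, then for all queries $Q$ and $Q'$: 1. $Q\approx_J Q'$ if and only if $Q\approx Q'$; 2. $Q\preceq_J Q'$ if and only if $Q\preceq Q'$. Moreover, if $Q$ and $Q'$ are equivalent queries in solved form, then they are isomorphic. -/

import Mathlib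

universe u v w w'

namespace QueryLattice

/-- The function-symbol part of an alphabet `L`. A structure for this language interprets exactly
the function symbols of `L`, so it is a pre-interpretation for `L`. -/
abbrev fnPart (L : FirstOrder.Language.{u, v}) : FirstOrder.Language.{u, 0} := ⟨L.Functions, fun _ => Empty⟩

/-- Terms over `L`; the denumerable set of variables is `ℕ`. -/
abbrev Tm (L : FirstOrder.Language.{u, v}) : Type u := (fnPart L).Term ℕ

/-- The free equality axioms of `L`, as a set of formulas without predicate symbols.
In the first two groups the variables `x₁, …, xₙ` are `0, …, n - 1` and the variables
`y₁, …, yₘ` are `n, …, n + m - 1`. -/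
inductive FEA (L : FirstOrder.Language.{u, v}) : (fnPart L).Formula ℕ → Prop
  | inj {n : ℕ} (f : L.Functions n) :
      FEA L (FirstOrder.Language.BoundedFormula.iff
        (FirstOrder.Language.Term.equal
          (FirstOrder.Language.Term.func (L := fnPart L) f fun i => FirstOrder.Language.Term.var (i : ℕ))
          (FirstOrder.Language.Term.func (L := fnPart L) f fun i => FirstOrder.Language.Term.var (n + (i : ℕ))))
        (FirstOrder.Language.BoundedFormula.iInf fun i : Fin n =>
          FirstOrder.Language.Term.equal (L := fnPart L) (FirstOrder.Language.Term.var (i : ℕ))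
            (FirstOrder.Language.Term.var (n + (i : ℕ)))))
  | clash {n m : ℕ} (f : L.Functions n) (g : L.Functions m)
      (hfg : (⟨n, f⟩ : Σ k, L.Functions k) ≠ ⟨m, g⟩) :
      FEA L (FirstOrder.Language.BoundedFormula.iff
        (FirstOrder.Language.Term.equal
          (FirstOrder.Language.Term.func (L := fnPart L) f fun i => FirstOrder.Language.Term.var (i : ℕ))
          (FirstOrder.Language.Term.func (L := fnPart L) g fun i => FirstOrder.Language.Term.var (n + (i : ℕ))))
        ⊥)
  | occurs (x : ℕ) (t : Tm L) (hne : t ≠ FirstOrder.Language.Term.var x) (hx : x ∈ t.varFinset) :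
      FEA L (FirstOrder.Language.BoundedFormula.iff
        (FirstOrder.Language.Term.equal (L := fnPart L) (FirstOrder.Language.Term.var x) t) ⊥)

/-- The pre-interpretation `J` is a model for the free equality axioms of `L`: every axiom is true
in `J` under every valuation. -/
def IsModelFEA (L : FirstOrder.Language.{u, v}) (J : Type w) [(fnPart L).Structure J] : Prop :=
  ∀ φ : (fnPart L).Formula ℕ, FEA L φ → ∀ h : ℕ → J, φ.Realize h

/-- A predicate symbol of `L` applied to a tuple of elements of `X`. For `X = Tm L` these are the
atoms; for a pre-interpretation `J` they form the `J`-base. -/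
structure GAtom (L : FirstOrder.Language.{u, v}) (X : Type w) where
  /-- the number of arguments -/
  arity : ℕ
  /-- the predicate symbol -/
  rel : L.Relations arity
  /-- the arguments -/
  args : Fin arity → X

/-- The generalized atom `h(A)`, for a function `h` on the arguments. -/
def GAtom.map {L : FirstOrder.Language.{u, v}} {X : Type w} {Y : Type w'} (h : X → Y) (A : GAtom L X) :
    GAtom L Y :=
  ⟨A.arity, A.rel, fun i => h (A.args i)⟩

/-- The variables of an atom. -/
def GAtom.vars {L : FirstOrder.Language.{u, v}} (A : GAtom L (Tm L)) : Finset ℕ :=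
  Finset.univ.biUnion fun i => (A.args i).varFinset

/-- An interpretation based on `J`, identified with a subset of the `J`-base. -/
abbrev Interp (L : FirstOrder.Language.{u, v}) (J : Type w) := Set (GAtom L J)

/-- Positive conjunctive queries. -/
inductive Query (L : FirstOrder.Language.{u, v})
  | tru : Query L
  | fls : Query L
  | eq (s t : Tm L) : Query L
  | atom (A : GAtom L (Tm L)) : Query L
  | and (Q₁ Q₂ : Query L) : Query L
  | ex (x : ℕ) (Q : Query L) : Query L

namespace Query

variable {L : FirstOrder.Language.{u, v}}

/-- The number `|Q|` of atoms occurring in `Q`. -/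
def card : Query L → ℕ
  | tru => 0
  | fls => 0
  | eq _ _ => 0
  | atom _ => 1
  | and Q₁ Q₂ => Q₁.card + Q₂.card
  | ex _ Q => Q.card

/-- The set of solutions of `Q` in a multiinterpretation based on `J`. It is only meaningful for a
multiinterpretation of length `Q.card`, and is only used for those. -/
def sol (J : Type w) [(fnPart L).Structure J] : Query L → List (Interp L J) → Set (ℕ → J)
  | tru, _ => Set.univ
  | fls, _ => ∅
  | eq s t, _ => {h | s.realize h = t.realize h}
  | atom A, Is => {h | ∃ I, Is = [I] ∧ A.map (fun t => t.realize h) ∈ I}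
  | and Q₁ Q₂, Is => sol J Q₁ (Is.take Q₁.card) ∩ sol J Q₂ (Is.drop Q₁.card)
  | ex x Q, Is => {h | ∃ d : J, Function.update h x d ∈ sol J Q Is}

/-- The preorder `Q ⪯_J Q'`. -/
def LeJ (J : Type w) [(fnPart L).Structure J] (Q Q' : Query L) : Prop :=
  Q.card = Q'.card ∧
    ∀ Is : List (Interp L J), Is.length = Q.card → Q.sol J Is ⊆ Q'.sol J Is

/-- The equivalence `Q ≈_J Q'`. -/
def EquivJ (J : Type w) [(fnPart L).Structure J] (Q Q' : Query L) : Prop :=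
  Q.card = Q'.card ∧
    ∀ Is : List (Interp L J), Is.length = Q.card → Q.sol J Is = Q'.sol J Is

/-- `Q ⪯ Q'`: the query `Q'` is more general than `Q`, that is, `Q ⪯_J Q'` for every
pre-interpretation `J` (with domain in `Type w`) that is a model for the free equality axioms. -/
def Le (Q Q' : Query L) : Prop :=
  ∀ (J : Type w) [Nonempty J] [(fnPart L).Structure J], IsModelFEA L J → LeJ J Q Q'

/-- `Q ≈ Q'`: the queries are equivalent. -/
def Equivalent (Q Q' : Query L) : Prop := Le.{u, v, w} Q Q' ∧ Le.{u, v, w} Q' Q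

/-- The free variables of a query. -/
def freeVars : Query L → Finset ℕ
  | tru => ∅
  | fls => ∅
  | eq s t => s.varFinset ∪ t.varFinset
  | atom A => A.vars
  | and Q₁ Q₂ => Q₁.freeVars ∪ Q₂.freeVars
  | ex x Q => Q.freeVars.erase x

/-- Simultaneous replacement of the free occurrences of each variable `x` by `σ x`. -/
def subst : (ℕ → Tm L) → Query L → Query L
  | _, tru => tru
  | _, fls => fls
  | σ, eq s t => eq (s.subst σ) (t.subst σ)
  | σ, atom A => atom (A.map fun t => t.subst σ)
  | σ, and Q₁ Q₂ => and (subst σ Q₁) (subst σ Q₂)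
  | σ, ex x Q => ex x (subst (Function.update σ x (FirstOrder.Language.Term.var x)) Q)

/-- For every variable `x`, the term `σ x` is substitutible for `x` in the query: no free
occurrence of `x` is in the scope of a quantifier on a variable of `σ x` (unless `σ x` is `x`). -/
def Substitutible : (ℕ → Tm L) → Query L → Prop
  | _, tru => True
  | _, fls => True
  | _, eq _ _ => True
  | _, atom _ => True
  | σ, and Q₁ Q₂ => Substitutible σ Q₁ ∧ Substitutible σ Q₂
  | σ, ex y Q => (∀ x ∈ Q.freeVars, x ≠ y → y ∉ (σ x).varFinset) ∧
      Substitutible (Function.update σ y (FirstOrder.Language.Term.var y)) Q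

/-- The substitution of the variable `y` for the variable `x`. -/
def single (x y : ℕ) : ℕ → Tm L :=
  Function.update FirstOrder.Language.Term.var x (FirstOrder.Language.Term.var y)

/-- One renaming of a bound variable: a part `(∃x) G` is replaced by `(∃y) G_x[y]`, where `y` is
not free in `G` and is substitutible for `x` in `G`. -/
inductive RenameStep : Query L → Query L → Prop
  | here (x y : ℕ) (G : Query L) (hy : y ∉ G.freeVars) (hs : Substitutible (single x y) G) :
      RenameStep (ex x G) (ex y (subst (single x y) G))
  | andLeft {G G' : Query L} (H : Query L) : RenameStep G G' → RenameStep (and G H) (and G' H)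
  | andRight {G G' : Query L} (H : Query L) : RenameStep G G' → RenameStep (and H G) (and H G')
  | ex (x : ℕ) {G G' : Query L} : RenameStep G G' → RenameStep (ex x G) (ex x G')

/-- `Q'` is a variant of `Q`. -/
def Variant (Q Q' : Query L) : Prop := Relation.ReflTransGen RenameStep Q Q'

/-- The query `(∃z₁) … (∃zₖ) Q`. -/
def exs (zs : List ℕ) (Q : Query L) : Query L := zs.foldr ex Q

/-- The members, from left to right, of a conjunction that may be bracketed in any way. -/
def conjuncts : Query L → List (Query L)
  | and Q₁ Q₂ => Q₁.conjuncts ++ Q₂.conjuncts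
  | Q => [Q]

/-- `Q` is `(∃z₁) … (∃zₖ) B` where `B` is the conjunction
`x₁ = s₁ ∧ … ∧ xₙ = sₙ ∧ A₁ ∧ … ∧ Aₘ`, whose bracketing is immaterial. Here `eqs` lists the pairs
`(xᵢ, sᵢ)`. -/
def HasForm (Q : Query L) (zs : List ℕ) (eqs : List (ℕ × Tm L)) (atoms : List (GAtom L (Tm L))) :
    Prop :=
  ∃ B : Query L, Q = exs zs B ∧
    B.conjuncts = eqs.map (fun e => eq (FirstOrder.Language.Term.var e.1) e.2) ++ atoms.map atom

/-- `Q` is in solved form. -/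
def Solved (Q : Query L) : Prop :=
  Q = tru ∨ Q = fls ∨
    ∃ (zs : List ℕ) (eqs : List (ℕ × Tm L)) (atoms : List (GAtom L (Tm L))),
      Q.HasForm zs eqs atoms ∧
      (eqs.map Prod.fst ++ zs).Nodup ∧
      (∀ x ∈ eqs.map Prod.fst,
        (∀ e ∈ eqs, x ∉ e.2.varFinset) ∧ ∀ A ∈ atoms, x ∉ A.vars) ∧
      (∀ z ∈ zs, (∃ e ∈ eqs, z ∈ e.2.varFinset) ∨ ∃ A ∈ atoms, z ∈ A.vars) ∧
      (∀ z ∈ zs, ∀ e ∈ eqs, e.2 ≠ FirstOrder.Language.Term.var z)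

/-- Permutation of equations and of bound variables. -/
def PermStep (Q Q' : Query L) : Prop :=
  ∃ (zs zs' : List ℕ) (eqs eqs' : List (ℕ × Tm L)) (atoms : List (GAtom L (Tm L))),
    Q.HasForm zs eqs atoms ∧ Q'.HasForm zs' eqs' atoms ∧ zs.Perm zs' ∧ eqs.Perm eqs'

/-- The substitution that exchanges `u` and `v` for each pair `(u, v)` of the list (whose entries
are to be distinct variables). -/
def swap : List (ℕ × ℕ) → ℕ → Tm L
  | [] => FirstOrder.Language.Term.var
  | p :: ps => Function.update (Function.update (swap ps) p.1 (FirstOrder.Language.Term.var p.2))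
      p.2 (FirstOrder.Language.Term.var p.1)

/-- Redirecting equations `u₁ = v₁, …, uₖ = vₖ` of `Q` between variables: `uᵢ` and `vᵢ` are
exchanged simultaneously throughout `Q`. -/
def RedirectStep (Q Q' : Query L) : Prop :=
  ∃ (zs : List ℕ) (eqs : List (ℕ × Tm L)) (atoms : List (GAtom L (Tm L))) (ps : List (ℕ × ℕ)),
    Q.HasForm zs eqs atoms ∧
    (∀ p ∈ ps, (p.1, FirstOrder.Language.Term.var p.2) ∈ eqs) ∧
    (ps.map Prod.fst ++ ps.map Prod.snd).Nodup ∧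
    Substitutible (swap ps) Q ∧
    Q' = subst (swap ps) Q

/-- `Q'` is isomorphic to the query `Q` in solved form. -/
def Isomorphic (Q Q' : Query L) : Prop :=
  Q.Solved ∧
    Relation.ReflTransGen (fun R R' => PermStep R R' ∨ Variant R R' ∨ RedirectStep R R') Q Q'

end Query

end QueryLattice

/-!
By unification, the equations of a query either fail in every model of the free equality axioms or
have a generic solution over terms, of which every solution in a model is an instance. Let
`Q ⪯_J Q'` and evaluate the atoms of `Q`, at a generic solution of `Q`, by singleton
interpretations: the literals of `Q'` become equations that are solvable in `J` for all values of
the parameters. In a non-trivial model no function symbol is surjective, so a most general unifier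
cannot restrict the parameters and yields a solution over terms, which is a solution in every model.

For equivalent solved forms the two generic solutions are instances of each other. As solved forms
bind no variable in vain, the instantiations restrict to inverse bijections of the bound variables.
A variable that is a left-hand side on one side only is matched with one that is a left-hand side on
the other side only, and redirecting the equations between such pairs makes the two forms equal up
to the order of the equations and the names of the bound variables.
-/

namespace QueryLattice

open FirstOrder.Language FirstOrder.Language.Structure

variable {L : FirstOrder.Language.{u, v}}

/-! ### Models of the free equality axioms -/

section Terms

variable {α γ : Type*}

theorem realize_congr [DecidableEq α] {ℒ : FirstOrder.Language} {M : Type*} [ℒ.Structure M]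
    {t : ℒ.Term α} {g h : α → M} (hgh : ∀ x ∈ t.varFinset, g x = h x) :
    t.realize g = t.realize h := by
  induction t with
  | var x => exact hgh x (by simp)
  | func f ts ih =>
    simp only [Term.realize_func]
    congr 1
    funext i
    exact ih i fun x hx => hgh x (by simpa using ⟨i, hx⟩)

/-- The terms over any set of variables as a pre-interpretation. Evaluating a term in it is
substitution, which lets valuations and substitutions be treated alike. -/
instance termStructure : (fnPart L).Structure ((fnPart L).Term γ) where
  funMap f ts := Term.func f ts
  RelMap r := r.elim

theorem realize_eq_subst (t : (fnPart L).Term α) (θ : α → (fnPart L).Term γ) :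
    t.realize θ = t.subst θ := by
  induction t with
  | var x => rfl
  | func f ts ih => exact congrArg (Term.func f) (funext ih)

theorem realize_realize {J : Type*} [(fnPart L).Structure J] (t : (fnPart L).Term α)
    (θ : α → (fnPart L).Term γ) (g : γ → J) :
    (t.realize θ).realize g = t.realize fun x => (θ x).realize g := by
  rw [realize_eq_subst, Term.realize_subst]

theorem realize_var_comp (t : (fnPart L).Term α) (f : α → γ) :
    (t.realize fun x => Term.var (f x)) = t.relabel f := by
  induction t with
  | var x => rfl
  | func g ts ih => exact congrArg (Term.func g) (funext ih)

theorem realize_var (t : (fnPart L).Term α) : t.realize Term.var = t :=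
  (realize_var_comp t id).trans (Term.relabel_id t)

theorem mem_varFinset_realize [DecidableEq α] [DecidableEq γ] {t : (fnPart L).Term α}
    {θ : α → (fnPart L).Term γ} {y : γ} :
    y ∈ (t.realize θ).varFinset ↔ ∃ x ∈ t.varFinset, y ∈ (θ x).varFinset := by
  induction t with
  | var x => simp
  | func f ts ih =>
    change y ∈ (Term.func f fun i => (ts i).realize θ).varFinset ↔ _
    simp only [Term.varFinset, Finset.mem_biUnion, Finset.mem_univ, true_and, ih]
    tauto

theorem mem_varFinset_relabel [DecidableEq α] [DecidableEq γ] {t : (fnPart L).Term α}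
    {f : α → γ} {y : γ} :
    y ∈ (t.relabel f).varFinset ↔ ∃ x ∈ t.varFinset, f x = y := by
  simp [← realize_var_comp, mem_varFinset_realize, eq_comm]

/-- The size of a term, on which unification proceeds by induction. Function symbols weigh more
than variables, so that turning an equation `t = x` into `x = t` is progress. -/
def termSize : (fnPart L).Term α → ℕ
  | Term.var _ => 1
  | Term.func _ ts => 2 + ∑ i, termSize (ts i)

theorem termSize_le_realize [DecidableEq α] {t : (fnPart L).Term α} {x : α} (hx : x ∈ t.varFinset)
    (θ : α → (fnPart L).Term γ) : termSize (θ x) ≤ termSize (t.realize θ) := by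
  induction t with
  | var y => simp_all
  | func f ts ih =>
    obtain ⟨i, hi⟩ : ∃ i, x ∈ (ts i).varFinset := by simpa using hx
    calc termSize (θ x) ≤ termSize ((ts i).realize θ) := ih i hi
      _ ≤ ∑ i, termSize ((ts i).realize θ) :=
        Finset.single_le_sum (f := fun i => termSize ((ts i).realize θ))
          (fun _ _ => Nat.zero_le _) (Finset.mem_univ i)
      _ ≤ 2 + ∑ i, termSize ((ts i).realize θ) := Nat.le_add_left _ _

end Terms

section Models

variable {J : Type*} [(fnPart L).Structure J] {α : Type*} [DecidableEq α]

theorem exists_valuation [Nonempty J] {n m : ℕ} (a : Fin n → J) (b : Fin m → J) :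
    ∃ h : ℕ → J, (∀ i : Fin n, h i = a i) ∧ ∀ i : Fin m, h (n + i) = b i := by
  inhabit J
  refine ⟨fun k => if hk : k < n + m then Fin.append a b ⟨k, hk⟩ else default,
    fun i => ?_, fun i => ?_⟩
  · exact (dif_pos (Nat.lt_add_right m i.2)).trans (Fin.append_left a b i)
  · exact (dif_pos (Nat.add_lt_add_left i.2 n)).trans (Fin.append_right a b i)

theorem IsModelFEA.injective (hJ : IsModelFEA L J) {n : ℕ} (f : L.Functions n) :
    Function.Injective (funMap (L := fnPart L) (M := J) f) := by
  intro a b hab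
  have : Nonempty J := ⟨funMap (L := fnPart L) f a⟩
  obtain ⟨h, ha, hb⟩ := exists_valuation a b
  have H := (BoundedFormula.realize_iff.1 (hJ _ (.inj f) h)).1
  rw [BoundedFormula.realize_iInf] at H
  change Formula.Realize _ _ → ∀ i, Formula.Realize _ _ at H
  simp only [Formula.realize_equal, Term.realize_func, Term.realize_var, ha, hb] at H
  exact funext (H hab)

theorem IsModelFEA.funMap_ne (hJ : IsModelFEA L J) {n m : ℕ} {f : L.Functions n}
    {g : L.Functions m} (hfg : (⟨n, f⟩ : Σ k, L.Functions k) ≠ ⟨m, g⟩) (a : Fin n → J)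
    (b : Fin m → J) : funMap (L := fnPart L) f a ≠ funMap (L := fnPart L) g b := by
  have : Nonempty J := ⟨funMap (L := fnPart L) f a⟩
  obtain ⟨h, ha, hb⟩ := exists_valuation a b
  have H := (BoundedFormula.realize_iff.1 (hJ _ (.clash f g hfg) h)).1
  change Formula.Realize _ _ → False at H
  simpa only [Formula.realize_equal, Term.realize_func, Term.realize_var, ha, hb] using H

theorem IsModelFEA.ne_realize (hJ : IsModelFEA L J) {x : α} {t : (fnPart L).Term α}
    (hne : t ≠ Term.var x) (hx : x ∈ t.varFinset) (g : α → J) : g x ≠ t.realize g := by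
  have : Nonempty α := ⟨x⟩
  -- The axioms are about the variables `ℕ`, into which the finitely many variables of `t` embed.
  obtain ⟨f, hf⟩ := Set.countable_iff_exists_injOn.1 t.varFinset.countable_toSet
  set h : ℕ → J := g ∘ Function.invFunOn f t.varFinset
  have h_apply : ∀ y ∈ t.varFinset, h (f y) = g y := fun y hy =>
    congrArg g (hf.leftInvOn_invFunOn hy)
  have hne' : t.relabel f ≠ Term.var (f x) := by
    cases t with
    | var y => exact fun H => hne (congrArg _ (hf (by simp) hx (Term.var.inj H)))
    | func => exact nofun
  have H := (BoundedFormula.realize_iff.1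
    (hJ _ (.occurs (f x) _ hne' (mem_varFinset_relabel.2 ⟨x, hx, rfl⟩)) h)).1
  change Formula.Realize _ _ → False at H
  rwa [Formula.realize_equal, Term.realize_var, Term.realize_relabel, h_apply x hx,
    realize_congr (g := h ∘ f) h_apply] at H

theorem isModelFEA_term {γ : Type*} : IsModelFEA L ((fnPart L).Term γ) := by
  rintro φ (@⟨n, f⟩ | @⟨n, m, f, g, hfg⟩ | @⟨x, t, hne, hx⟩) h
  · refine BoundedFormula.realize_iff.2 ?_
    rw [BoundedFormula.realize_iInf]
    change Formula.Realize _ _ ↔ ∀ i, Formula.Realize _ _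
    simp only [Formula.realize_equal, Term.realize_func, Term.realize_var]
    refine ⟨fun H => ?_, fun H => congrArg _ (funext H)⟩
    obtain ⟨-, -, H⟩ := Term.func.inj H
    exact congrFun (eq_of_heq H)
  · refine BoundedFormula.realize_iff.2 ⟨fun H => ?_, False.elim⟩
    obtain ⟨rfl, H, -⟩ := Term.func.inj (Formula.realize_equal.1 H)
    exact hfg (by rw [eq_of_heq H])
  · refine BoundedFormula.realize_iff.2 ⟨fun H => ?_, False.elim⟩
    replace H : h x = t.realize h := Formula.realize_equal.1 H
    cases t with
    | var y => simp_all
    | func f ts =>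
      obtain ⟨i, hi⟩ : ∃ i, x ∈ (ts i).varFinset := by simpa using hx
      have hle := (termSize_le_realize hi h).trans
        (Finset.single_le_sum (f := fun i => termSize ((ts i).realize h))
          (fun _ _ => Nat.zero_le _) (Finset.mem_univ i))
      have hsize : termSize (h x) = 2 + ∑ i, termSize ((ts i).realize h) := by rw [H]; rfl
      lia

theorem IsModelFEA.eq_of_realize_eq (hJ : IsModelFEA L J) {t : (fnPart L).Term α} {g h : α → J}
    (heq : t.realize g = t.realize h) : ∀ x ∈ t.varFinset, g x = h x := by
  induction t with
  | var x => simpa using heq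
  | func f ts ih =>
    intro x hx
    obtain ⟨i, hi⟩ : ∃ i, x ∈ (ts i).varFinset := by simpa using hx
    exact ih i (congrFun (hJ.injective f heq) i) x hi

instance {γ : Type*} [Nontrivial γ] : Nontrivial ((fnPart L).Term γ) :=
  (show Function.Injective (Term.var (L := fnPart L)) from fun _ _ => Term.var.inj).nontrivial

end Models

/-! ### Unification -/

section Unification

/-- Equations between terms in the variables `α`. -/
abbrev Equation (L : FirstOrder.Language.{u, v}) (α : Type*) : Type _ :=
  (fnPart L).Term α × (fnPart L).Term α

variable {J : Type*} [(fnPart L).Structure J] {α : Type*}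

/-- The valuation `g` solves the equations `E`. If `g` takes values in the pre-interpretation of
terms, it is a substitution and this says that it unifies `E`. -/
def Solves (g : α → J) (E : List (Equation L α)) : Prop :=
  ∀ e ∈ E, e.1.realize g = e.2.realize g

theorem solves_cons {g : α → J} {e : Equation L α} {E : List (Equation L α)} :
    Solves g (e :: E) ↔ e.1.realize g = e.2.realize g ∧ Solves g E :=
  List.forall_mem_cons

theorem solves_flip {g : α → J} {t u : (fnPart L).Term α} {E : List (Equation L α)} :
    Solves g ((t, u) :: E) ↔ Solves g ((u, t) :: E) := by
  simp only [solves_cons, eq_comm]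

theorem solves_append {g : α → J} {E₁ E₂ : List (Equation L α)} :
    Solves g (E₁ ++ E₂) ↔ Solves g E₁ ∧ Solves g E₂ :=
  List.forall_mem_append

theorem solves_map {β : Type*} {g : β → J} {σ : α → (fnPart L).Term β} {E : List (Equation L α)} :
    Solves g (E.map (Prod.map (Term.realize σ) (Term.realize σ))) ↔
      Solves (fun x => (σ x).realize g) E := by
  simp only [Solves, List.forall_mem_map, Prod.map_fst, Prod.map_snd, realize_realize]

theorem solves_cons_func (hJ : IsModelFEA L J) {g : α → J} {n : ℕ} {f : L.Functions n}
    {ts us : Fin n → (fnPart L).Term α} {E : List (Equation L α)} :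
    Solves g ((Term.func f ts, Term.func f us) :: E) ↔
      Solves g (List.ofFn (fun i => (ts i, us i)) ++ E) := by
  rw [solves_cons, solves_append]
  refine and_congr_left' ?_
  simp only [Solves, List.forall_mem_ofFn_iff, Term.realize_func, (hJ.injective f).eq_iff,
    funext_iff]

/-- The substitution `θ` is an idempotent most general unifier of the equations `E` with respect to
`J`: it unifies `E`, and every solution of `E` in `J` is its own composition with `θ`. -/
def IsMgu (J : Type*) [(fnPart L).Structure J]
    (E : List (Equation L α)) (θ : α → (fnPart L).Term α) : Prop :=
  Solves θ E ∧ ∀ g : α → J, Solves g E → ∀ x, (θ x).realize g = g x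

theorem IsMgu.congr {E E' : List (Equation L α)} {θ : α → (fnPart L).Term α} (hθ : IsMgu J E' θ)
    (hterm : Solves θ E' → Solves θ E) (hmodel : ∀ g : α → J, Solves g E → Solves g E') :
    IsMgu J E θ :=
  ⟨hterm hθ.1, fun g hg => hθ.2 g (hmodel g hg)⟩

/-- The size of a list of equations. The factor `2` rewards moving a variable to the left. -/
def eqSize (E : List (Equation L α)) : ℕ :=
  (E.map fun e => 2 * termSize e.1 + termSize e.2).sum

theorem eqSize_decompose_lt {n : ℕ} (f : L.Functions n) (ts us : Fin n → (fnPart L).Term α)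
    (E : List (Equation L α)) : eqSize (List.ofFn (fun i => (ts i, us i)) ++ E) <
      eqSize ((Term.func f ts, Term.func f us) :: E) := by
  simp only [eqSize, List.map_append, List.map_ofFn, List.sum_append, List.sum_ofFn, List.map_cons,
    List.sum_cons, termSize, Function.comp_apply, Finset.sum_add_distrib, ← Finset.mul_sum]
  lia

theorem termSize_pos (t : (fnPart L).Term α) : 0 < termSize t := by
  cases t <;> simp [termSize]

theorem eqSize_tail_lt (e : Equation L α)
    (E : List (Equation L α)) : eqSize E < eqSize (e :: E) := by
  have := termSize_pos e.2
  simp only [eqSize, List.map_cons, List.sum_cons]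
  lia

theorem eqSize_flip_lt (x : α) {n : ℕ} (f : L.Functions n) (ts : Fin n → (fnPart L).Term α)
    (E : List (Equation L α)) :
    eqSize ((Term.var x, Term.func f ts) :: E) < eqSize ((Term.func f ts, Term.var x) :: E) := by
  simp only [eqSize, List.map_cons, List.sum_cons, termSize]
  lia

section Elimination

variable [DecidableEq α]

/-- The equations `E` with `t` substituted for the variable `x`, as in a unification step that has
solved `x = t`. -/
def eliminate (x : α) (t : (fnPart L).Term α) (E : List (Equation L α)) : List (Equation L α) :=
  E.map (Prod.map (Term.realize (Function.update Term.var x t))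
    (Term.realize (Function.update Term.var x t)))

theorem realize_update_eq_self {x : α} {t : (fnPart L).Term α} {g : α → J}
    (hg : g x = t.realize g) : (fun y => (Function.update Term.var x t y).realize g) = g := by
  funext y
  obtain rfl | hy := eq_or_ne y x
  · simpa using hg.symm
  · simp [hy]

theorem solves_eliminate {x : α} {t : (fnPart L).Term α}
    {E : List (Equation L α)} {g : α → J} (hg : g x = t.realize g)
    (hE : Solves g E) : Solves g (eliminate x t E) :=
  solves_map.2 (by rwa [realize_update_eq_self hg])

theorem IsMgu.cons_var {x : α} {t : (fnPart L).Term α} (hx : x ∉ t.varFinset)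
    {E : List (Equation L α)} {θ : α → (fnPart L).Term α} (hθ : IsMgu J (eliminate x t E) θ) :
    IsMgu J ((Term.var x, t) :: E) fun y => (Function.update Term.var x t y).realize θ := by
  set σ := Function.update (Term.var (L := fnPart L)) x t
  have hσt : t.realize σ = t := by
    refine (realize_congr fun y hy => ?_).trans (realize_var t)
    exact Function.update_of_ne (ne_of_mem_of_not_mem hy hx) ..
  refine ⟨solves_cons.2 ⟨?_, solves_map.1 hθ.1⟩, fun g hg y => ?_⟩
  · rw [Term.realize_var, ← realize_realize, hσt]
    simp [σ]
  · obtain ⟨hgx, hgE⟩ := solves_cons.1 hg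
    calc ((σ y).realize θ).realize g = (σ y).realize fun z => (θ z).realize g :=
          realize_realize ..
      _ = (σ y).realize g := by
        congr 1
        exact funext (hθ.2 g (solves_eliminate hgx hgE))
      _ = g y := congrFun (realize_update_eq_self hgx) y

/-- The variables of a list of equations. -/
def eqVars (E : List (Equation L α)) : Finset α :=
  E.foldr (fun e s => e.1.varFinset ∪ e.2.varFinset ∪ s) ∅

theorem mem_eqVars {E : List (Equation L α)} {x : α} :
    x ∈ eqVars E ↔ ∃ e ∈ E, x ∈ e.1.varFinset ∨ x ∈ e.2.varFinset := by
  induction E with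
  | nil => simp [eqVars]
  | cons e E ih =>
    rw [eqVars, List.foldr_cons, ← eqVars]
    simp [ih, or_assoc]

theorem card_eqVars_eliminate_lt {x : α} {t : (fnPart L).Term α} (hx : x ∉ t.varFinset)
    (E : List (Equation L α)) :
    (eqVars (eliminate x t E)).card < (eqVars ((Term.var x, t) :: E)).card := by
  have hσ : ∀ (s : (fnPart L).Term α) (y : α),
      y ∈ (s.realize (Function.update (Term.var (L := fnPart L)) x t)).varFinset →
      y ≠ x ∧ (y ∈ s.varFinset ∨ y ∈ t.varFinset) := by
    intro s y hy
    obtain ⟨z, hz, hyz⟩ := mem_varFinset_realize.1 hy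
    obtain rfl | hzx := eq_or_ne z x
    · rw [Function.update_self] at hyz
      exact ⟨ne_of_mem_of_not_mem hyz hx, .inr hyz⟩
    · obtain rfl : y = z := by simpa [hzx] using hyz
      exact ⟨hzx, .inl hz⟩
  refine Finset.card_lt_card ((Finset.ssubset_iff_of_subset fun y hy => ?_).2 ⟨x, ?_, ?_⟩)
  · simp only [mem_eqVars, eliminate, List.mem_map, exists_exists_and_eq_and, Prod.map_fst,
      Prod.map_snd] at hy
    obtain ⟨e, he, hy⟩ := hy
    have := hy.imp (hσ e.1 y) (hσ e.2 y)
    simp only [mem_eqVars, List.mem_cons, exists_eq_or_imp]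
    grind
  · exact mem_eqVars.2 ⟨_, List.mem_cons_self, by simp⟩
  · simp only [mem_eqVars, eliminate, List.mem_map, exists_exists_and_eq_and, Prod.map_fst,
      Prod.map_snd]
    rintro ⟨e, -, he | he⟩ <;> exact (hσ _ _ he).1 rfl

theorem eqVars_decompose_subset {n : ℕ} (f : L.Functions n) (ts us : Fin n → (fnPart L).Term α)
    (E : List (Equation L α)) : eqVars (List.ofFn (fun i => (ts i, us i)) ++ E) ⊆
      eqVars ((Term.func f ts, Term.func f us) :: E) := by
  intro y hy
  obtain ⟨e, he, hy⟩ := mem_eqVars.1 hy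
  rcases List.mem_append.1 he with he | he
  · obtain ⟨i, rfl⟩ := List.mem_ofFn.1 he
    exact mem_eqVars.2 ⟨_, List.mem_cons_self, by simpa using hy.imp (⟨i, ·⟩) (⟨i, ·⟩)⟩
  · exact mem_eqVars.2 ⟨e, List.mem_cons_of_mem _ he, hy⟩

theorem eqVars_tail_subset (e : Equation L α)
    (E : List (Equation L α)) : eqVars E ⊆ eqVars (e :: E) :=
  Finset.subset_union_right

theorem eqVars_flip (t u : (fnPart L).Term α) (E : List (Equation L α)) :
    eqVars ((t, u) :: E) = eqVars ((u, t) :: E) := by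
  simp only [eqVars, List.foldr_cons, Finset.union_comm t.varFinset]

end Elimination

theorem exists_isMgu (hJ : IsModelFEA L J) (E : List (Equation L α))
    (hE : ∃ g : α → J, Solves g E) : ∃ θ, IsMgu J E θ := by
  classical
  induction E using (invImage (fun E : List (Equation L α) =>
    ((eqVars E).card, eqSize E)) Prod.instWellFoundedRelation).wf.induction with | _ E ih
  match E with
  | [] => exact ⟨Term.var, by simp [IsMgu, Solves]⟩
  | (Term.var x, t) :: E =>
    by_cases hx : x ∈ t.varFinset
    · obtain rfl : t = Term.var x := by
        obtain ⟨g, hg⟩ := hE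
        exact of_not_not fun hne => hJ.ne_realize hne hx g (solves_cons.1 hg).1
      obtain ⟨θ, hθ⟩ := ih E
        (.right' _ (Finset.card_le_card (eqVars_tail_subset ..)) (eqSize_tail_lt ..))
        (hE.imp fun g hg => (solves_cons.1 hg).2)
      exact ⟨θ, hθ.congr (fun h => solves_cons.2 ⟨rfl, h⟩) fun g hg => (solves_cons.1 hg).2⟩
    · have hE' : ∃ g : α → J, Solves g (eliminate x t E) := by
        obtain ⟨g, hg⟩ := hE
        obtain ⟨hgx, hgE⟩ := solves_cons.1 hg
        exact ⟨g, solves_eliminate hgx hgE⟩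
      obtain ⟨θ, hθ⟩ := ih _ (.left _ _ (card_eqVars_eliminate_lt hx E)) hE'
      exact ⟨_, hθ.cons_var hx⟩
  | (Term.func f ts, Term.var x) :: E =>
    obtain ⟨θ, hθ⟩ := ih ((Term.var x, Term.func f ts) :: E)
      (.right' _ (congrArg Finset.card (eqVars_flip ..)).le (eqSize_flip_lt ..))
      (hE.imp fun g => solves_flip.1)
    exact ⟨θ, hθ.congr solves_flip.1 fun g => solves_flip.1⟩
  | (Term.func (l := n) f ts, Term.func (l := m) g us) :: E =>
    by_cases hfg : (⟨n, f⟩ : Σ k, L.Functions k) = ⟨m, g⟩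
    · cases hfg
      obtain ⟨θ, hθ⟩ := ih (List.ofFn (fun i => (ts i, us i)) ++ E)
        (.right' _ (Finset.card_le_card (eqVars_decompose_subset ..)) (eqSize_decompose_lt ..))
        (hE.imp fun g => (solves_cons_func hJ).1)
      exact ⟨θ, hθ.congr (solves_cons_func isModelFEA_term).2 fun g => (solves_cons_func hJ).1⟩
    · obtain ⟨h, hh⟩ := hE
      exact absurd (solves_cons.1 hh).1 (hJ.funMap_ne hfg _ _)

end Unification

section GenericSolutions

variable {J : Type*} [(fnPart L).Structure J] {α β γ : Type*}

theorem IsModelFEA.exists_notMem_range_funMap [Nontrivial J] (hL : Nonempty (L.Functions 0))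
    (hJ : IsModelFEA L J) {n : ℕ} (f : L.Functions n) :
    ∃ d, d ∉ Set.range (funMap (L := fnPart L) (M := J) f) := by
  obtain ⟨c⟩ := hL
  obtain rfl | hn := eq_or_ne n 0
  · obtain ⟨d, hd⟩ := exists_ne (funMap (L := fnPart L) (M := J) f Fin.elim0)
    refine ⟨d, ?_⟩
    rintro ⟨a, rfl⟩
    exact hd (congrArg _ (Subsingleton.elim a Fin.elim0))
  · refine ⟨funMap (L := fnPart L) c Fin.elim0, ?_⟩
    rintro ⟨a, ha⟩
    exact hJ.funMap_ne (fun h => hn (congrArg Sigma.fst h)) a Fin.elim0 ha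

theorem IsModelFEA.exists_eq_var_of_surjective [Nontrivial J] (hL : Nonempty (L.Functions 0))
    (hJ : IsModelFEA L J) {t : (fnPart L).Term α}
    (ht : ∀ d : J, ∃ g : α → J, t.realize g = d) : ∃ x, t = Term.var x := by
  cases t with
  | var x => exact ⟨x, rfl⟩
  | func f ts =>
    obtain ⟨d, hd⟩ := hJ.exists_notMem_range_funMap hL f
    obtain ⟨g, rfl⟩ := ht d
    exact absurd ⟨_, rfl⟩ hd

theorem Solves.comp {θ : α → (fnPart L).Term γ} {E : List (Equation L α)} (hθ : Solves θ E)
    (g : γ → J) : Solves (fun x => (θ x).realize g) E := fun e he => by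
  rw [← realize_realize, hθ e he, realize_realize]

/-- If the parameters can take all values in a non-trivial model, then a most general unifier merely
renames them, so that renaming them back expresses the unknowns in terms of the parameters. -/
theorem exists_generic_solution [Nontrivial J] (hL : Nonempty (L.Functions 0))
    (hJ : IsModelFEA L J) {E : List (Equation L (α ⊕ β))}
    (hE : ∀ k : α → J, ∃ m : β → J, Solves (Sum.elim k m) E) :
    ∃ μ : β → (fnPart L).Term α, Solves (Sum.elim Term.var μ) E := by
  obtain ⟨d, d', hd⟩ := exists_pair_ne J
  obtain ⟨θ, hθE, hθ⟩ := exists_isMgu hJ E ((hE fun _ => d).imp' _ fun _ => id)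
  have hvar : ∀ a, ∃ y, θ (Sum.inl a) = Term.var y := fun a =>
    hJ.exists_eq_var_of_surjective hL fun e => by
      obtain ⟨m, hm⟩ := hE fun _ => e
      exact ⟨_, hθ _ hm (Sum.inl a)⟩
  choose r hr using hvar
  have hr_inj : Function.Injective r := by
    classical
    intro a a' haa'
    by_contra hne
    obtain ⟨m, hm⟩ := hE (Function.update (fun _ => d) a d')
    have hθa := hθ _ hm (Sum.inl a)
    have hθa' := hθ _ hm (Sum.inl a')
    rw [hr] at hθa hθa'
    simp only [Term.realize_var, haa', Sum.elim_inl, Function.update_self,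
      Function.update_of_ne (Ne.symm hne)] at hθa hθa'
    exact hd (hθa'.symm.trans hθa)
  obtain ⟨c⟩ := hL
  set δ : α ⊕ β → (fnPart L).Term α :=
    Function.extend r Term.var fun _ => Term.func (L := fnPart L) c Fin.elim0
  refine ⟨fun b => (θ (Sum.inr b)).realize δ, ?_⟩
  convert hθE.comp δ with y
  obtain a | b := y
  · simp [hr, δ, hr_inj.extend_apply]
  · rfl

end GenericSolutions

section Atoms

variable {X Y : Type*}

theorem GAtom.map_map {Z : Type*} (f : X → Y) (g : Y → Z) (A : GAtom L X) :
    (A.map f).map g = A.map (g ∘ f) :=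
  rfl

theorem map_map_eq_map_map_iff {f g : X → Y} {As : List (GAtom L X)} :
    As.map (GAtom.map f) = As.map (GAtom.map g) ↔ ∀ A ∈ As, ∀ i, f (A.args i) = g (A.args i) := by
  simp [List.map_inj_left, GAtom.map, funext_iff]

theorem map_map_eq_self_iff {f : X → X} {As : List (GAtom L X)} :
    As.map (GAtom.map f) = As ↔ ∀ A ∈ As, ∀ i, f (A.args i) = A.args i :=
  (Eq.congr_right (List.map_id As).symm).trans (map_map_eq_map_map_iff (g := id))

/-- The pairs of arguments at the same positions of two atoms; there are none if the numbers of
arguments differ. -/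
def GAtom.argPairs (A B : GAtom L X) : List (X × X) :=
  if h : A.arity = B.arity then List.ofFn fun i => (A.args i, B.args (Fin.cast h i)) else []

/-- The pairs of corresponding arguments of two lists of atoms. -/
def argPairs (As Bs : List (GAtom L X)) : List (X × X) :=
  (List.zipWith GAtom.argPairs As Bs).flatten

/-- Mapping into `Unit` keeps just the predicate symbol of an atom. -/
theorem GAtom.map_eq_map_iff {h : X → Y} {A B : GAtom L X} :
    A.map h = B.map h ↔ A.map (fun _ => ()) = B.map (fun _ => ()) ∧
      ∀ e ∈ A.argPairs B, h e.1 = h e.2 := by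
  obtain ⟨n, p, a⟩ := A
  obtain ⟨m, q, b⟩ := B
  by_cases hnm : n = m
  · subst hnm
    simp [GAtom.map, GAtom.argPairs, funext_iff]
  · simp [GAtom.map, hnm]

theorem map_eq_map_iff_argPairs {h : X → Y} {As Bs : List (GAtom L X)} :
    As.map (GAtom.map h) = Bs.map (GAtom.map h) ↔
      As.map (GAtom.map fun _ => ()) = Bs.map (GAtom.map fun _ => ()) ∧
        ∀ e ∈ argPairs As Bs, h e.1 = h e.2 := by
  induction As generalizing Bs with
  | nil => cases Bs <;> simp [argPairs]
  | cons A As ih =>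
    cases Bs with
    | nil => simp
    | cons B Bs =>
      simp only [argPairs] at ih
      simp only [argPairs, List.map_cons, List.cons.injEq, GAtom.map_eq_map_iff (h := h), ih,
        List.zipWith_cons_cons, List.flatten_cons, List.forall_mem_append]
      tauto

variable {J : Type*} [(fnPart L).Structure J] {α β γ : Type*}

/-- Each of the atoms holds, under the valuation `g`, in the corresponding interpretation. -/
def AtomsSat (g : α → J) (As : List (GAtom L ((fnPart L).Term α))) (Is : List (Interp L J)) :
    Prop :=
  List.Forall₂ (fun A I => A.map (Term.realize g) ∈ I) As Is

theorem atomsSat_map {g : β → J} {σ : α → (fnPart L).Term β}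
    {As : List (GAtom L ((fnPart L).Term α))} {Is : List (Interp L J)} :
    AtomsSat g (As.map (GAtom.map (Term.realize σ))) Is ↔
      AtomsSat (fun x => (σ x).realize g) As Is := by
  simp only [AtomsSat, List.forall₂_map_left_iff, GAtom.map_map, Function.comp_def,
    realize_realize]

theorem atomsSat_singletons {g : α → J} {As : List (GAtom L ((fnPart L).Term α))}
    {Bs : List (GAtom L J)} :
    AtomsSat g As (Bs.map ({·})) ↔ As.map (GAtom.map (Term.realize g)) = Bs := by
  simp [AtomsSat, List.forall₂_map_right_iff, ← List.forall₂_eq_eq_eq, List.forall₂_map_left_iff]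

theorem atomsSat_append {g : α → J} {As Bs : List (GAtom L ((fnPart L).Term α))}
    {Is : List (Interp L J)} : AtomsSat g (As ++ Bs) Is ↔
      AtomsSat g As (Is.take As.length) ∧ AtomsSat g Bs (Is.drop As.length) := by
  simp only [AtomsSat]
  induction As generalizing Is with
  | nil => simp
  | cons A As ih => cases Is <;> simp [ih, and_assoc]

/-- Equations and atoms: the quantifier-free part of a query, as a sequence of literals. -/
structure Body (L : FirstOrder.Language.{u, v}) (α : Type*) where
  /-- the equations -/
  eqs : List (Equation L α)
  /-- the atoms, from left to right -/
  atoms : List (GAtom L ((fnPart L).Term α))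

namespace Body

/-- Satisfaction of the equations, and of the `j`-th atom in the `j`-th interpretation. -/
def Sat (b : Body L α) (g : α → J) (Is : List (Interp L J)) : Prop :=
  Solves g b.eqs ∧ AtomsSat g b.atoms Is

/-- Application of a substitution. -/
def subst (σ : α → (fnPart L).Term β) (b : Body L α) : Body L β :=
  ⟨b.eqs.map (Prod.map (Term.realize σ) (Term.realize σ)),
    b.atoms.map (GAtom.map (Term.realize σ))⟩

/-- Conjunction. -/
def append (b₁ b₂ : Body L α) : Body L α :=
  ⟨b₁.eqs ++ b₂.eqs, b₁.atoms ++ b₂.atoms⟩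

theorem sat_subst {b : Body L α} {σ : α → (fnPart L).Term β} {g : β → J} {Is : List (Interp L J)} :
    (b.subst σ).Sat g Is ↔ b.Sat (fun x => (σ x).realize g) Is :=
  and_congr solves_map atomsSat_map

theorem sat_append {b₁ b₂ : Body L α} {n : ℕ} (hn : b₁.atoms.length = n) {g : α → J}
    {Is : List (Interp L J)} :
    (b₁.append b₂).Sat g Is ↔ b₁.Sat g (Is.take n) ∧ b₂.Sat g (Is.drop n) := by
  rw [Sat, Sat, Sat, append, solves_append, atomsSat_append, hn]
  tauto

theorem Sat.map_realize {b : Body L α} {g : α → (fnPart L).Term γ}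
    {Bs : List (GAtom L ((fnPart L).Term γ))} (h : b.Sat g (Bs.map ({·}))) {k : γ → J}
    {Is : List (Interp L J)} (hk : AtomsSat k Bs Is) : b.Sat (fun x => (g x).realize k) Is := by
  refine ⟨h.1.comp k, ?_⟩
  rwa [← atomsSat_map, atomsSat_singletons.1 h.2]

/-- The equations between terms in the variables `γ` and `β` which say that `b` holds with `t a` for
the variable `a : α` and that its atoms become `Bs`. -/
def matching (b : Body L (α ⊕ β)) (t : α → (fnPart L).Term γ)
    (Bs : List (GAtom L ((fnPart L).Term γ))) : List (Equation L (γ ⊕ β)) :=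
  let b' := b.subst (Sum.elim (fun a => (t a).relabel Sum.inl) fun y => Term.var (Sum.inr y))
  b'.eqs ++ argPairs b'.atoms (Bs.map (GAtom.map (Term.relabel Sum.inl)))

theorem sat_singletons_iff_matching {b : Body L (α ⊕ β)} {t : α → (fnPart L).Term γ}
    {Bs : List (GAtom L ((fnPart L).Term γ))} {k : γ → J} {m : β → J} :
    b.Sat (Sum.elim (fun a => (t a).realize k) m)
        ((Bs.map (GAtom.map (Term.realize k))).map ({·})) ↔
      b.atoms.map (GAtom.map fun _ => ()) = Bs.map (GAtom.map fun _ => ()) ∧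
        Solves (Sum.elim k m) (b.matching t Bs) := by
  set σ : α ⊕ β → (fnPart L).Term (γ ⊕ β) :=
    Sum.elim (fun a => (t a).relabel Sum.inl) fun y => Term.var (Sum.inr y)
  have hσ : (fun x => (σ x).realize (Sum.elim k m)) = Sum.elim (fun a => (t a).realize k) m := by
    funext x
    cases x <;> simp [σ]
  have hBs : Bs.map (GAtom.map (Term.realize k)) =
      (Bs.map (GAtom.map (Term.relabel Sum.inl))).map
        (GAtom.map (Term.realize (Sum.elim k m))) := by
    simp [GAtom.map_map, Function.comp_def]
  rw [← hσ, ← sat_subst, Sat, atomsSat_singletons, hBs, map_eq_map_iff_argPairs, matching,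
    solves_append, Solves, Solves]
  simp only [subst, List.map_map, Function.comp_def, GAtom.map_map]
  tauto

theorem exists_term_sat [Nontrivial J] (hL : Nonempty (L.Functions 0)) (hJ : IsModelFEA L J)
    {b : Body L (α ⊕ β)} {t : α → (fnPart L).Term γ} {Bs : List (GAtom L ((fnPart L).Term γ))}
    (hb : ∀ k : γ → J, ∃ m : β → J, b.Sat (Sum.elim (fun a => (t a).realize k) m)
      ((Bs.map (GAtom.map (Term.realize k))).map ({·}))) :
    ∃ μ : β → (fnPart L).Term γ, b.Sat (Sum.elim t μ) (Bs.map ({·})) := by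
  simp only [sat_singletons_iff_matching] at hb
  obtain ⟨μ, hμ⟩ := exists_generic_solution hL hJ fun k => (hb k).imp fun m hm => hm.2
  obtain ⟨d⟩ : Nonempty J := inferInstance
  obtain ⟨m, hsymbols, -⟩ := hb fun _ => d
  have h := sat_singletons_iff_matching.2 ⟨hsymbols, hμ⟩
  have hid : GAtom.map (L := L) (Term.realize Term.var : (fnPart L).Term γ → _) = id :=
    funext fun A => by simp [GAtom.map, realize_var]
  exact ⟨μ, by simpa only [realize_var, hid, List.map_id] using h⟩

end Body

end Atoms

/-! ### Comparison of models -/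

namespace Query

section Prenex

/-- The occurrences of existential quantifiers in a query; they serve as the names of its bound
variables. -/
def Witness : Query L → Type
  | tru => Empty
  | fls => Empty
  | eq _ _ => Empty
  | atom _ => Empty
  | and Q₁ Q₂ => Q₁.Witness ⊕ Q₂.Witness
  | ex _ Q => Option Q.Witness

/-- The literals of a query, with its bound variables named by the quantifiers that bind them: the
quantifier-free part of a prenex form. The constant `FALSE` is ignored. -/
def body : (Q : Query L) → Body L (ℕ ⊕ Q.Witness)
  | tru => ⟨[], []⟩
  | fls => ⟨[], []⟩
  | eq s t => ⟨[(s.relabel Sum.inl, t.relabel Sum.inl)], []⟩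
  | atom A => ⟨[], [A.map (Term.relabel Sum.inl)]⟩
  | and Q₁ Q₂ =>
    (Q₁.body.subst (Sum.elim (fun x => Term.var (Sum.inl x))
      fun w => Term.var (Sum.inr (Sum.inl w)))).append
    (Q₂.body.subst (Sum.elim (fun x => Term.var (Sum.inl x))
      fun w => Term.var (Sum.inr (Sum.inr w))))
  | ex x Q => Q.body.subst (Sum.elim
      (Function.update (fun y => Term.var (Sum.inl y)) x (Term.var (Sum.inr none)))
      fun w => Term.var (Sum.inr (some w)))

/-- The constant `FALSE` does not occur in the query. -/
def FalseFree : Query L → Prop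
  | tru => True
  | fls => False
  | eq _ _ => True
  | atom _ => True
  | and Q₁ Q₂ => Q₁.FalseFree ∧ Q₂.FalseFree
  | ex _ Q => Q.FalseFree

theorem length_body_atoms (Q : Query L) : Q.body.atoms.length = Q.card := by
  induction Q with
  | tru | fls | eq | atom => rfl
  | and Q₁ Q₂ ih₁ ih₂ =>
    exact List.length_append.trans
      (congrArg₂ _ (List.length_map _ |>.trans ih₁) (List.length_map _ |>.trans ih₂))
  | ex x Q ih => exact (List.length_map _).trans ih

variable {J : Type*} [(fnPart L).Structure J]

theorem sat_body_and {Q₁ Q₂ : Query L} {h : ℕ → J} {w₁ : Q₁.Witness → J} {w₂ : Q₂.Witness → J}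
    {Is : List (Interp L J)} :
    (and Q₁ Q₂).body.Sat (Sum.elim h (Sum.elim w₁ w₂)) Is ↔
      Q₁.body.Sat (Sum.elim h w₁) (Is.take Q₁.card) ∧
        Q₂.body.Sat (Sum.elim h w₂) (Is.drop Q₁.card) := by
  refine (Body.sat_append ((List.length_map _).trans (length_body_atoms Q₁))).trans ?_
  refine and_congr (Body.sat_subst.trans (iff_of_eq ?_)) (Body.sat_subst.trans (iff_of_eq ?_)) <;>
  · congr 1
    funext x
    cases x <;> rfl

theorem sat_body_ex {x : ℕ} {Q : Query L} {h : ℕ → J} {d : J} {w : Q.Witness → J}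
    {Is : List (Interp L J)} :
    (ex x Q).body.Sat (Sum.elim h (Option.elim · d w)) Is ↔
      Q.body.Sat (Sum.elim (Function.update h x d) w) Is := by
  refine Body.sat_subst.trans (iff_of_eq ?_)
  congr 1
  funext y
  obtain y | y := y
  · obtain rfl | hy := eq_or_ne y x
    · simp only [Sum.elim_inl, Function.update_self]
      rfl
    · simp [hy]
  · rfl

theorem exists_sat_body_and {Q₁ Q₂ : Query L} {h : ℕ → J} {Is : List (Interp L J)} :
    (∃ w, (and Q₁ Q₂).body.Sat (Sum.elim h w) Is) ↔
      (∃ w₁, Q₁.body.Sat (Sum.elim h w₁) (Is.take Q₁.card)) ∧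
        ∃ w₂, Q₂.body.Sat (Sum.elim h w₂) (Is.drop Q₁.card) := by
  constructor
  · rintro ⟨w, hw⟩
    rw [← Sum.elim_comp_inl_inr w] at hw
    exact (sat_body_and.1 hw).imp (⟨_, ·⟩) (⟨_, ·⟩)
  · rintro ⟨⟨w₁, h₁⟩, w₂, h₂⟩
    exact ⟨Sum.elim w₁ w₂, sat_body_and.2 ⟨h₁, h₂⟩⟩

theorem exists_sat_body_ex {x : ℕ} {Q : Query L} {h : ℕ → J} {Is : List (Interp L J)} :
    (∃ w, (ex x Q).body.Sat (Sum.elim h w) Is) ↔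
      ∃ d, ∃ w, Q.body.Sat (Sum.elim (Function.update h x d) w) Is := by
  constructor
  · rintro ⟨w, hw⟩
    have hw_elim : w = (Option.elim · (w none) (w ∘ some)) := by
      funext y
      cases y <;> rfl
    rw [hw_elim] at hw
    exact ⟨w none, w ∘ some, sat_body_ex.1 hw⟩
  · rintro ⟨d, w, hw⟩
    exact ⟨_, sat_body_ex.2 hw⟩

theorem mem_sol_iff {Q : Query L} {h : ℕ → J} {Is : List (Interp L J)}
    (hIs : Is.length = Q.card) :
    h ∈ Q.sol J Is ↔ Q.FalseFree ∧ ∃ w : Q.Witness → J, Q.body.Sat (Sum.elim h w) Is := by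
  induction Q generalizing h Is with
  | tru =>
    obtain rfl := List.eq_nil_of_length_eq_zero hIs
    exact iff_of_true trivial ⟨trivial, Empty.elim, by simp [body, Body.Sat, Solves, AtomsSat]⟩
  | fls => simp [sol, FalseFree]
  | eq s t =>
    obtain rfl := List.eq_nil_of_length_eq_zero hIs
    have hsat (w : (eq s t).Witness → J) :
        (eq s t).body.Sat (Sum.elim h w) [] ↔ s.realize h = t.realize h := by
      simp [body, Body.Sat, Solves, AtomsSat]
    simp only [sol, FalseFree, hsat, true_and, Set.mem_ofPred_eq]
    exact (exists_const_iff.trans (and_iff_right ⟨Empty.elim⟩)).symm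
  | atom A =>
    obtain ⟨I, rfl⟩ := List.length_eq_one_iff.1 hIs
    have hsat (w : (atom A).Witness → J) :
        (atom A).body.Sat (Sum.elim h w) [I] ↔ A.map (Term.realize h) ∈ I := by
      simp [body, Body.Sat, Solves, AtomsSat, GAtom.map]
    simp only [FalseFree, hsat, true_and]
    refine Iff.trans ?_ (exists_const_iff.trans (and_iff_right ⟨Empty.elim⟩)).symm
    simp [sol]
  | and Q₁ Q₂ ih₁ ih₂ =>
    simp only [card] at hIs
    rw [sol, Set.mem_inter_iff, ih₁ (by simp [hIs]), ih₂ (by simp [hIs]), exists_sat_body_and]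
    exact and_and_and_comm
  | ex x Q ih =>
    simp only [sol, Set.mem_ofPred_eq, ih hIs]
    rw [exists_sat_body_ex]
    exact exists_and_left

end Prenex

section Transfer

theorem LeJ.transfer {J : Type w} [(fnPart L).Structure J] [Nontrivial J] {K : Type w'}
    [(fnPart L).Structure K] (hL : Nonempty (L.Functions 0)) (hJ : IsModelFEA L J)
    (hK : IsModelFEA L K) {Q Q' : Query L} (hle : LeJ J Q Q') : LeJ K Q Q' := by
  refine ⟨hle.1, fun Is hIs h hh => ?_⟩
  obtain ⟨hf, w, hw⟩ := (mem_sol_iff hIs).1 hh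
  obtain ⟨θ, hθ, hθ_comp⟩ := exists_isMgu hK Q.body.eqs ⟨_, hw.1⟩
  set Bs := Q.body.atoms.map (GAtom.map (Term.realize θ))
  have hBs : Bs.length = Q.card := by simp [Bs, length_body_atoms]
  have hQ : Q.body.Sat θ (Bs.map ({·})) := ⟨hθ, atomsSat_singletons.2 rfl⟩
  have hQ' : ∀ k : ℕ ⊕ Q.Witness → J, (fun x => (θ (Sum.inl x)).realize k) ∈
      Q'.sol J ((Bs.map (GAtom.map (Term.realize k))).map ({·})) := fun k => by
    refine hle.2 _ (by simp [hBs]) ((mem_sol_iff (by simp [hBs])).2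
      ⟨hf, fun y => (θ (Sum.inr y)).realize k, ?_⟩)
    have h := hQ.map_realize (k := k) (Is := (Bs.map (GAtom.map (Term.realize k))).map ({·}))
      (atomsSat_singletons.2 rfl)
    rwa [← Sum.elim_comp_inl_inr fun x => (θ x).realize k] at h
  simp only [mem_sol_iff, List.length_map, hBs, hle.1] at hQ'
  obtain ⟨d⟩ : Nonempty J := inferInstance
  obtain ⟨μ, hμ⟩ := Body.exists_term_sat hL hJ fun k => (hQ' k).2
  refine (mem_sol_iff (hIs.trans hle.1)).2 ⟨(hQ' fun _ => d).1,
    fun y => (μ y).realize (Sum.elim h w), ?_⟩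
  convert hμ.map_realize (k := Sum.elim h w) (Is := Is) ?_ using 1
  · funext x
    obtain x | x := x
    · exact (hθ_comp _ hw.1 (Sum.inl x)).symm
    · rfl
  · rw [atomsSat_map, funext (hθ_comp _ hw.1)]
    exact hw.2

theorem leJ_iff_le {J : Type w} [(fnPart L).Structure J] [Nontrivial J]
    (hL : Nonempty (L.Functions 0)) (hJ : IsModelFEA L J) {Q Q' : Query L} :
    LeJ J Q Q' ↔ Le.{u, v, max u w'} Q Q' :=
  ⟨fun hle _ _ _ hK => hle.transfer hL hJ hK,
    fun hle => (hle ((fnPart L).Term (ULift.{w'} ℕ)) isModelFEA_term).transfer hL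
      isModelFEA_term hJ⟩

theorem equivJ_iff {J : Type*} [(fnPart L).Structure J] {Q Q' : Query L} :
    EquivJ J Q Q' ↔ LeJ J Q Q' ∧ LeJ J Q' Q := by
  constructor
  · rintro ⟨hcard, hsol⟩
    exact ⟨⟨hcard, fun Is hIs => (hsol Is hIs).subset⟩,
      ⟨hcard.symm, fun Is hIs => (hsol Is (hIs.trans hcard.symm)).superset⟩⟩
  · rintro ⟨⟨hcard, hle⟩, -, hge⟩
    exact ⟨hcard, fun Is hIs => (hle Is hIs).antisymm (hge Is (hIs.trans hcard))⟩

theorem equivJ_iff_equivalent {J : Type w} [(fnPart L).Structure J] [Nontrivial J]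
    (hL : Nonempty (L.Functions 0)) (hJ : IsModelFEA L J) {Q Q' : Query L} :
    EquivJ J Q Q' ↔ Equivalent.{u, v, max u w'} Q Q' :=
  equivJ_iff.trans (and_congr (leJ_iff_le.{u, v, w, w'} hL hJ) (leJ_iff_le.{u, v, w, w'} hL hJ))

end Transfer

end Query

/-! ### Solved forms -/

section SwapVar

variable {α : Type*} [DecidableEq α]

/-- The function that exchanges `u` and `v` for each pair `(u, v)` of the list. -/
def swapVar : List (α × α) → α → α
  | [] => id
  | p :: ps => Function.update (Function.update (swapVar ps) p.1 p.2) p.2 p.1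

theorem swapVar_of_notMem {ps : List (α × α)} {x : α} (hfst : x ∉ ps.map Prod.fst)
    (hsnd : x ∉ ps.map Prod.snd) : swapVar ps x = x := by
  induction ps with
  | nil => rfl
  | cons p ps ih =>
    simp only [List.map_cons, List.mem_cons, not_or] at hfst hsnd
    rw [swapVar, Function.update_of_ne hsnd.1, Function.update_of_ne hfst.1, ih hfst.2 hsnd.2]

theorem swapVar_of_mem {ps : List (α × α)} (hps : (ps.map Prod.fst ++ ps.map Prod.snd).Nodup)
    {p : α × α} (hp : p ∈ ps) : swapVar ps p.1 = p.2 ∧ swapVar ps p.2 = p.1 := by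
  induction ps with
  | nil => cases hp
  | cons q ps ih =>
    simp only [List.map_cons, List.cons_append, List.nodup_cons, List.nodup_append',
      List.mem_append, List.mem_cons, List.disjoint_cons_right, not_or] at hps ih
    obtain ⟨⟨hq₁, hq, hq₁₂⟩, hfst, ⟨hq₂, hsnd⟩, hq₂₁, hdisj⟩ := hps
    obtain rfl | hp := List.mem_cons.1 hp
    · simp [swapVar, Function.update_of_ne hq]
    · have hp₁ := List.mem_map_of_mem (f := Prod.fst) hp
      have hp₂ := List.mem_map_of_mem (f := Prod.snd) hp
      simpa [swapVar, Function.update_apply, ne_of_mem_of_not_mem hp₁ hq₁,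
        ne_of_mem_of_not_mem hp₁ hq₂₁, ne_of_mem_of_not_mem hp₂ hq₁₂,
        ne_of_mem_of_not_mem hp₂ hq₂] using ih ⟨hfst, hsnd, hdisj⟩ hp

theorem swapVar_involutive {ps : List (α × α)}
    (hps : (ps.map Prod.fst ++ ps.map Prod.snd).Nodup) : Function.Involutive (swapVar ps) := by
  intro x
  by_cases hfst : x ∈ ps.map Prod.fst
  · obtain ⟨p, hp, rfl⟩ := List.mem_map.1 hfst
    rw [(swapVar_of_mem hps hp).1, (swapVar_of_mem hps hp).2]
  by_cases hsnd : x ∈ ps.map Prod.snd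
  · obtain ⟨p, hp, rfl⟩ := List.mem_map.1 hsnd
    rw [(swapVar_of_mem hps hp).2, (swapVar_of_mem hps hp).1]
  · rw [swapVar_of_notMem hfst hsnd, swapVar_of_notMem hfst hsnd]

end SwapVar

/-- The data of a query `∃ β, x₁ = s₁ ∧ … ∧ xₙ = sₙ ∧ A₁ ∧ … ∧ Aₘ`. Bound variables are kept apart
from the free variables `α`, so there is no capture. -/
structure Form (L : FirstOrder.Language.{u, v}) (α β : Type*) where
  /-- the equations `xᵢ = sᵢ` -/
  eqs : List (α × (fnPart L).Term (α ⊕ β))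
  /-- the atoms, from left to right -/
  atoms : List (GAtom L ((fnPart L).Term (α ⊕ β)))

namespace Form

variable {α β β' : Type*}

/-- The left-hand sides of the equations. -/
def heads (S : Form L α β) : List α :=
  S.eqs.map Prod.fst

/-- The right-hand sides of the equations and the arguments of the atoms. -/
def terms (S : Form L α β) : Set ((fnPart L).Term (α ⊕ β)) :=
  {t | (∃ e ∈ S.eqs, e.2 = t) ∨ ∃ A ∈ S.atoms, ∃ i, A.args i = t}

/-- Renaming of the free and of the bound variables. -/
def relabel (f : α → α) (e : β → β') (S : Form L α β) : Form L α β' :=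
  ⟨S.eqs.map (Prod.map f (Term.relabel (Sum.map f e))),
    S.atoms.map (GAtom.map (Term.relabel (Sum.map f e)))⟩

/-- Satisfaction of a form, its atoms being evaluated in successive interpretations. -/
def Sat {J : Type*} [(fnPart L).Structure J] (S : Form L α β) (h : α → J) (Is : List (Interp L J)) :
    Prop :=
  ∃ k : β → J, (∀ e ∈ S.eqs, h e.1 = e.2.realize (Sum.elim h k)) ∧
    AtomsSat (Sum.elim h k) S.atoms Is

/-- The solved forms. -/
structure IsSolved [DecidableEq α] [DecidableEq β] (S : Form L α β) : Prop where
  nodup_heads : S.heads.Nodup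
  head_notMem : ∀ x ∈ S.heads, ∀ t ∈ S.terms, Sum.inl x ∉ t.varFinset
  exists_mem (b : β) : ∃ t ∈ S.terms, Sum.inr b ∈ t.varFinset
  ne_var : ∀ e ∈ S.eqs, ∀ b, e.2 ≠ Term.var (Sum.inr b)

open Classical in
/-- The generic solution of a solved form: heads are evaluated by their equations, and the other
variables are parameters. -/
noncomputable def value (S : Form L α β) (x : α) : (fnPart L).Term (α ⊕ β) :=
  if h : ∃ t, (x, t) ∈ S.eqs then h.choose else Term.var (Sum.inl x)

/-- The generic solution of `S`, together with `k`, is a solution of `S'`. -/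
def IsInstance (S : Form L α β) (S' : Form L α β') (k : β' → (fnPart L).Term (α ⊕ β)) : Prop :=
  (∀ x, (S'.value x).realize (Sum.elim S.value k) = S.value x) ∧
    S'.atoms.map (GAtom.map (Term.realize (Sum.elim S.value k))) = S.atoms

theorem value_of_notMem {S : Form L α β} {x : α} (hx : x ∉ S.heads) :
    S.value x = Term.var (Sum.inl x) :=
  dif_neg fun ⟨_, ht⟩ => hx (List.mem_map_of_mem (f := Prod.fst) ht)

theorem mem_eqs_value {S : Form L α β} {x : α} (hx : x ∈ S.heads) : (x, S.value x) ∈ S.eqs := by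
  obtain ⟨⟨x, t⟩, ht, rfl⟩ := List.mem_map.1 hx
  have hex : ∃ t, (x, t) ∈ S.eqs := ⟨t, ht⟩
  rw [value, dif_pos hex]
  exact hex.choose_spec

theorem value_mem_terms {S : Form L α β} {x : α} (hx : x ∈ S.heads) : S.value x ∈ S.terms :=
  Or.inl ⟨_, mem_eqs_value hx, rfl⟩

variable [DecidableEq α] [DecidableEq β] {S : Form L α β} {S' : Form L α β'}

theorem IsSolved.value_eq (hS : S.IsSolved) {e : α × (fnPart L).Term (α ⊕ β)} (he : e ∈ S.eqs) :
    S.value e.1 = e.2 :=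
  congrArg Prod.snd (List.inj_on_of_nodup_map hS.nodup_heads
    (mem_eqs_value (List.mem_map_of_mem he)) he rfl)

theorem IsSolved.value_ne_var_inr (hS : S.IsSolved) (x : α) (b : β) :
    S.value x ≠ Term.var (Sum.inr b) := by
  by_cases hx : x ∈ S.heads
  · exact hS.ne_var _ (mem_eqs_value hx) b
  · simp [value_of_notMem hx]

theorem IsSolved.realize_value (hS : S.IsSolved) {t : (fnPart L).Term (α ⊕ β)} (ht : t ∈ S.terms) :
    t.realize (Sum.elim S.value fun b => Term.var (Sum.inr b)) = t := by
  refine (realize_congr fun y hy => ?_).trans (realize_var t)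
  obtain x | b := y
  · exact value_of_notMem fun hx => hS.head_notMem x hx t ht hy
  · rfl

theorem IsSolved.sat_value (hS : S.IsSolved) : S.Sat S.value (S.atoms.map ({·})) := by
  refine ⟨fun b => Term.var (Sum.inr b), fun e he => ?_, atomsSat_singletons.2
    (map_map_eq_self_iff.2 fun A hA i => hS.realize_value (Or.inr ⟨A, hA, i, rfl⟩))⟩
  rw [hS.value_eq he, hS.realize_value (Or.inl ⟨e, he, rfl⟩)]

theorem IsSolved.exists_isInstance (hS : S.IsSolved)
    (hle : ∀ (h : α → (fnPart L).Term (α ⊕ β)) (Is : List (Interp L ((fnPart L).Term (α ⊕ β)))),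
      S.Sat h Is → S'.Sat h Is) : ∃ k, S.IsInstance S' k := by
  obtain ⟨k, heqs, hatoms⟩ := hle _ _ hS.sat_value
  refine ⟨k, fun x => ?_, atomsSat_singletons.1 hatoms⟩
  by_cases hx : x ∈ S'.heads
  · exact (heqs _ (mem_eqs_value hx)).symm
  · simp [value_of_notMem hx]

namespace IsInstance

variable {k : β' → (fnPart L).Term (α ⊕ β)} {k' : β → (fnPart L).Term (α ⊕ β')}

theorem realize_realize (h : S.IsInstance S' k) (h' : S'.IsInstance S k') (hS : S.IsSolved)
    {t : (fnPart L).Term (α ⊕ β)} (ht : t ∈ S.terms) :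
    (t.realize (Sum.elim S'.value k')).realize (Sum.elim S.value k) = t := by
  obtain ⟨e, he, rfl⟩ | ⟨A, hA, i, rfl⟩ := ht
  · rw [← hS.value_eq he, h'.1, h.1]
  · have hmap := h.2
    rw [← h'.2, List.map_map] at hmap
    exact (map_map_eq_self_iff (f := Term.realize _ ∘ Term.realize _)).1 hmap A hA i

theorem exists_eq_var_inr (h : S.IsInstance S' k) (h' : S'.IsInstance S k') (hS : S.IsSolved)
    (b : β) : ∃ b', k' b = Term.var (Sum.inr b') ∧ k b' = Term.var (Sum.inr b) := by
  obtain ⟨t, ht, hb⟩ := hS.exists_mem b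
  have hvar : (k' b).realize (Sum.elim S.value k) = Term.var (Sum.inr b) := by
    have hfix := h.realize_realize h' hS ht
    rw [QueryLattice.realize_realize] at hfix
    exact isModelFEA_term.eq_of_realize_eq (hfix.trans (realize_var t).symm) _ hb
  generalize k' b = u at hvar
  cases u with
  | func f ts => cases hvar
  | var y =>
    obtain y | b' := y
    · exact absurd hvar (hS.value_ne_var_inr y b)
    · exact ⟨b', rfl, hvar⟩

theorem exists_eq_var_inl (h : S.IsInstance S' k) (h' : S'.IsInstance S k') (hS : S.IsSolved)
    {x : α} (hx : x ∉ S'.heads) :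
    ∃ y, S.value x = Term.var (Sum.inl y) ∧ S'.value y = Term.var (Sum.inl x) := by
  have hvar := (h'.1 x).trans (value_of_notMem hx)
  generalize S.value x = u at hvar
  cases u with
  | func f ts => cases hvar
  | var y =>
    obtain y | b := y
    · exact ⟨y, rfl, hvar⟩
    · obtain ⟨b', hb', -⟩ := h.exists_eq_var_inr h' hS b
      cases hb'.symm.trans hvar

theorem exists_equiv [DecidableEq β'] (h : S.IsInstance S' k) (h' : S'.IsInstance S k')
    (hS : S.IsSolved) (hS' : S'.IsSolved) : ∃ e : β ≃ β', ∀ b, k' b = Term.var (Sum.inr (e b)) := by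
  choose f hf using h.exists_eq_var_inr h' hS
  choose g hg using h'.exists_eq_var_inr h hS'
  refine ⟨⟨f, g, fun b => ?_, fun b' => ?_⟩, fun b => (hf b).1⟩
  · simpa using (hg (f b)).1.symm.trans (hf b).2
  · simpa using (hf (g b')).1.symm.trans (hg b').2

theorem exists_partner (h : S.IsInstance S' k) (h' : S'.IsInstance S k') (hS : S.IsSolved) {x : α}
    (hx : x ∈ S.heads) (hx' : x ∉ S'.heads) :
    ∃ y, S.value x = Term.var (Sum.inl y) ∧ S'.value y = Term.var (Sum.inl x) ∧ y ∉ S.heads ∧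
      y ∈ S'.heads := by
  obtain ⟨y, hxy, hyx⟩ := h.exists_eq_var_inl h' hS hx'
  have hy : y ∉ S.heads := fun hy => hS.head_notMem y hy _ (value_mem_terms hx) (by simp [hxy])
  refine ⟨y, hxy, hyx, hy, by_contra fun hy' => hy ?_⟩
  rw [value_of_notMem hy'] at hyx
  cases hyx
  exact hx

theorem exists_partners (h : S.IsInstance S' k) (h' : S'.IsInstance S k') (hS : S.IsSolved) :
    ∃ ps : List (α × α), (ps.map Prod.fst ++ ps.map Prod.snd).Nodup ∧
      (∀ x, x ∈ ps.map Prod.fst ↔ x ∈ S.heads ∧ x ∉ S'.heads) ∧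
      ∀ p ∈ ps, S.value p.1 = Term.var (Sum.inl p.2) ∧ S'.value p.2 = Term.var (Sum.inl p.1) ∧
        p.2 ∉ S.heads ∧ p.2 ∈ S'.heads := by
  choose! y hy using fun x (hx : x ∈ S.heads ∧ x ∉ S'.heads) => h.exists_partner h' hS hx.1 hx.2
  set xs := S.heads.filter (· ∉ S'.heads)
  have hxs {x} : x ∈ xs ↔ x ∈ S.heads ∧ x ∉ S'.heads := by simp [xs]
  have hy_inj : ∀ x₁ ∈ xs, ∀ x₂ ∈ xs, y x₁ = y x₂ → x₁ = x₂ := fun x₁ hx₁ x₂ hx₂ heq =>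
    Sum.inl_injective (Term.var.inj
      ((hy x₁ (hxs.1 hx₁)).2.1.symm.trans (heq ▸ (hy x₂ (hxs.1 hx₂)).2.1)))
  refine ⟨xs.map fun x => (x, y x), ?_, fun x => by simp [Function.comp_def, hxs], ?_⟩
  · simp only [List.map_map, Function.comp_def, List.map_id']
    refine List.nodup_append'.2 ⟨hS.nodup_heads.filter _,
      (hS.nodup_heads.filter _).map_on hy_inj, fun x hx hyx => ?_⟩
    obtain ⟨x', hx', rfl⟩ := List.mem_map.1 hyx
    exact (hy x' (hxs.1 hx')).2.2.1 (hxs.1 hx).1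
  · exact List.forall_mem_map.2 fun x hx => hy x (hxs.1 hx)

theorem exists_swap [DecidableEq β'] (h : S.IsInstance S' k) (h' : S'.IsInstance S k')
    (hS : S.IsSolved) (hS' : S'.IsSolved) :
    ∃ ps : List (α × α), (∀ p ∈ ps, (p.1, Term.var (Sum.inl p.2)) ∈ S.eqs) ∧
      (ps.map Prod.fst ++ ps.map Prod.snd).Nodup ∧
      (∀ x ∉ S.heads, S'.value x = Term.var (Sum.inl (swapVar ps x))) ∧
      ∀ x ∈ S.heads, (swapVar ps x, S'.value x) ∈ S'.eqs := by
  obtain ⟨ps, hnodup, hfst, hps⟩ := h.exists_partners h' hS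
  have hsnd {x} (hx : x ∈ ps.map Prod.snd) : x ∉ S.heads ∧ x ∈ S'.heads := by
    obtain ⟨p, hp, rfl⟩ := List.mem_map.1 hx
    exact (hps p hp).2.2
  have hswap {x y} (hx : x ∈ S.heads) (hx' : x ∉ S'.heads)
      (hxy : S.value x = Term.var (Sum.inl y)) : swapVar ps x = y ∧ swapVar ps y = x := by
    obtain ⟨p, hp, rfl⟩ := List.mem_map.1 ((hfst x).2 ⟨hx, hx'⟩)
    cases (hps p hp).1.symm.trans hxy
    exact swapVar_of_mem hnodup hp
  refine ⟨ps, fun p hp => ?_, hnodup, fun x hx => ?_, fun x hx => ?_⟩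
  · rw [← (hps p hp).1]
    exact mem_eqs_value ((hfst _).1 (List.mem_map_of_mem hp)).1
  · by_cases hx' : x ∈ S'.heads
    · obtain ⟨y, hxy, hyx, hy', hy⟩ := h'.exists_partner h hS' hx' hx
      rw [hxy, (hswap hy hy' hyx).2]
    · rw [value_of_notMem hx', swapVar_of_notMem (fun hp => hx ((hfst x).1 hp).1)
        fun hp => hx' (hsnd hp).2]
  · by_cases hx' : x ∈ S'.heads
    · rw [swapVar_of_notMem (fun hp => ((hfst x).1 hp).2 hx') fun hp => (hsnd hp).1 hx]
      exact mem_eqs_value hx'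
    · obtain ⟨y, hxy, hyx, -, hy'⟩ := h.exists_partner h' hS hx hx'
      rw [(hswap hx hx' hxy).1, value_of_notMem hx', ← hyx]
      exact mem_eqs_value hy'

theorem exists_relabel_subperm [DecidableEq β'] (h : S.IsInstance S' k) (h' : S'.IsInstance S k')
    (hS : S.IsSolved) (hS' : S'.IsSolved) : ∃ (ps : List (α × α)) (e : β ≃ β'),
      (∀ p ∈ ps, (p.1, Term.var (Sum.inl p.2)) ∈ S.eqs) ∧
      (ps.map Prod.fst ++ ps.map Prod.snd).Nodup ∧
      (S.relabel (swapVar ps) e).eqs.Subperm S'.eqs ∧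
      (S.relabel (swapVar ps) e).atoms = S'.atoms := by
  obtain ⟨e, he⟩ := h.exists_equiv h' hS hS'
  obtain ⟨ps, hps, hnodup, hvalue, heqs⟩ := h.exists_swap h' hS hS'
  have hterms : ∀ t ∈ S.terms,
      t.relabel (Sum.map (swapVar ps) e) = t.realize (Sum.elim S'.value k') := fun t ht => by
    rw [← realize_var_comp]
    refine realize_congr fun y hy => ?_
    obtain x | b := y
    · exact (hvalue x fun hx => hS.head_notMem x hx t ht hy).symm
    · exact (he b).symm
  have hheads : ((S.relabel (swapVar ps) e).eqs.map Prod.fst).Nodup := by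
    have hswap := hS.nodup_heads.map (swapVar_involutive hnodup).injective
    simpa [relabel, heads, Function.comp_def] using hswap
  refine ⟨ps, e, hps, hnodup, hheads.of_map.subperm (List.forall_mem_map.2 fun q hq => ?_), ?_⟩
  · rw [Prod.map, hterms q.2 (Or.inl ⟨q, hq, rfl⟩), ← hS.value_eq hq, h'.1]
    exact heqs q.1 (List.mem_map_of_mem hq)
  · rw [← h'.2]
    exact map_map_eq_map_map_iff.2 fun A hA i => hterms _ (Or.inr ⟨A, hA, i, rfl⟩)

end IsInstance

theorem IsSolved.exists_relabel_perm [DecidableEq β'] (hS : S.IsSolved) (hS' : S'.IsSolved)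
    (hle : ∀ (h : α → (fnPart L).Term (α ⊕ β)) (Is : List (Interp L ((fnPart L).Term (α ⊕ β)))),
      S.Sat h Is → S'.Sat h Is)
    (hge : ∀ (h : α → (fnPart L).Term (α ⊕ β')) (Is : List (Interp L ((fnPart L).Term (α ⊕ β')))),
      S'.Sat h Is → S.Sat h Is) :
    ∃ (ps : List (α × α)) (e : β ≃ β'), (∀ p ∈ ps, (p.1, Term.var (Sum.inl p.2)) ∈ S.eqs) ∧
      (ps.map Prod.fst ++ ps.map Prod.snd).Nodup ∧
      (S.relabel (swapVar ps) e).eqs.Perm S'.eqs ∧ (S.relabel (swapVar ps) e).atoms = S'.atoms := by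
  obtain ⟨k, hk⟩ := hS.exists_isInstance hle
  obtain ⟨k', hk'⟩ := hS'.exists_isInstance hge
  obtain ⟨ps, e, hps, hnodup, heqs, hatoms⟩ := hk.exists_relabel_subperm hk' hS hS'
  obtain ⟨ps', e', -, -, heqs', -⟩ := hk'.exists_relabel_subperm hk hS' hS
  have hlength := heqs'.length_le
  exact ⟨ps, e, hps, hnodup, heqs.perm_of_length_le (by simpa [relabel] using hlength), hatoms⟩

end Form

/-! ### Renaming of bound variables -/

theorem GAtom.mem_vars {A : GAtom L (Tm L)} {x : ℕ} :
    x ∈ A.vars ↔ ∃ i, x ∈ (A.args i).varFinset := by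
  simp [GAtom.vars]

namespace Query

section Substitution

/-- The query has no quantifiers. -/
def QuantifierFree : Query L → Prop
  | and Q₁ Q₂ => Q₁.QuantifierFree ∧ Q₂.QuantifierFree
  | ex _ _ => False
  | _ => True

/-- The query obtained by replacing the free occurrences of each variable `x` by `f x`. -/
def relabel (f : ℕ → ℕ) (Q : Query L) : Query L :=
  Q.subst fun x => Term.var (f x)

theorem subst_congr {Q : Query L} {σ τ : ℕ → Tm L} (h : ∀ x ∈ Q.freeVars, σ x = τ x) :
    Q.subst σ = Q.subst τ := by
  induction Q generalizing σ τ with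
  | tru | fls => rfl
  | eq s t =>
    simp only [freeVars, Finset.mem_union] at h
    simp only [subst, ← realize_eq_subst, realize_congr fun x hx => h x (Or.inl hx),
      realize_congr fun x hx => h x (Or.inr hx)]
  | atom A =>
    simp only [subst, GAtom.map, ← realize_eq_subst]
    congr 2
    exact funext fun i => realize_congr fun x hx => h x (GAtom.mem_vars.2 ⟨i, hx⟩)
  | and Q₁ Q₂ ih₁ ih₂ =>
    simp only [freeVars, Finset.mem_union] at h
    rw [subst, subst, ih₁ fun x hx => h x (Or.inl hx), ih₂ fun x hx => h x (Or.inr hx)]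
  | ex y Q ih =>
    simp only [freeVars, Finset.mem_erase] at h
    rw [subst, subst, ih fun x hx => ?_]
    obtain rfl | hxy := eq_or_ne x y
    · simp
    · simp [hxy, h x ⟨hxy, hx⟩]

namespace QuantifierFree

variable {Q : Query L}

theorem subst_subst (hQ : Q.QuantifierFree) (σ τ : ℕ → Tm L) :
    (Q.subst σ).subst τ = Q.subst fun x => (σ x).subst τ := by
  induction Q with
  | tru | fls => rfl
  | eq s t => simp only [subst, ← realize_eq_subst, realize_realize]
  | atom A => simp only [subst, GAtom.map, ← realize_eq_subst, realize_realize]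
  | and Q₁ Q₂ ih₁ ih₂ => simp only [subst, ih₁ hQ.1, ih₂ hQ.2]
  | ex => exact hQ.elim

theorem subst (hQ : Q.QuantifierFree) (σ : ℕ → Tm L) : (Q.subst σ).QuantifierFree := by
  induction Q with
  | tru | fls | eq | atom => trivial
  | and Q₁ Q₂ ih₁ ih₂ => exact ⟨ih₁ hQ.1, ih₂ hQ.2⟩
  | ex => exact hQ.elim

theorem mem_freeVars_relabel (hQ : Q.QuantifierFree) {f : ℕ → ℕ} {y : ℕ} :
    y ∈ (Q.relabel f).freeVars ↔ ∃ x ∈ Q.freeVars, f x = y := by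
  rw [relabel]
  induction Q with
  | tru | fls => simp [Query.subst, freeVars]
  | eq s t =>
    simp only [Query.subst, freeVars, ← realize_eq_subst, Finset.mem_union, realize_var_comp,
      mem_varFinset_relabel, or_and_right, exists_or]
  | atom A =>
    simp only [Query.subst, freeVars, ← realize_eq_subst, GAtom.mem_vars, GAtom.map,
      realize_var_comp, mem_varFinset_relabel]
    tauto
  | and Q₁ Q₂ ih₁ ih₂ =>
    simp only [Query.subst, freeVars, Finset.mem_union, ih₁ hQ.1, ih₂ hQ.2, or_and_right, exists_or]
  | ex => exact hQ.elim

theorem substitutible (hQ : Q.QuantifierFree) (σ : ℕ → Tm L) : Q.Substitutible σ := by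
  induction Q with
  | tru | fls | eq | atom => trivial
  | and Q₁ Q₂ ih₁ ih₂ => exact ⟨ih₁ hQ.1, ih₂ hQ.2⟩
  | ex => exact hQ.elim

theorem substitutible_exs (hQ : Q.QuantifierFree) {zs : List ℕ} {σ : ℕ → Tm L}
    (hfix : ∀ z ∈ zs, σ z = Term.var z)
    (hσ : ∀ z ∈ zs, ∀ x, x ≠ z → z ∉ (σ x).varFinset) : (exs zs Q).Substitutible σ := by
  induction zs with
  | nil => exact hQ.substitutible σ
  | cons z zs ih =>
    simp only [List.forall_mem_cons] at hfix hσ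
    refine ⟨fun x _ => hσ.1 x, ?_⟩
    rw [← hfix.1, Function.update_eq_self]
    exact ih hfix.2 hσ.2

end QuantifierFree

theorem subst_exs {zs : List ℕ} {Q : Query L} {σ : ℕ → Tm L} (hfix : ∀ z ∈ zs, σ z = Term.var z) :
    (exs zs Q).subst σ = exs zs (Q.subst σ) := by
  induction zs with
  | nil => rfl
  | cons z zs ih =>
    rw [List.forall_mem_cons] at hfix
    change ex z ((exs zs Q).subst (Function.update σ z (Term.var z))) = ex z _
    rw [← hfix.1, Function.update_eq_self, ih hfix.2]
    rfl

theorem mem_freeVars_exs {zs : List ℕ} {Q : Query L} {x : ℕ} :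
    x ∈ (exs zs Q).freeVars ↔ x ∉ zs ∧ x ∈ Q.freeVars := by
  induction zs with
  | nil => simp [exs]
  | cons z zs ih =>
    change x ∈ (exs zs Q).freeVars.erase z ↔ _
    simp only [Finset.mem_erase, ih, List.mem_cons, not_or, and_assoc]

theorem conjuncts_subst (Q : Query L) (σ : ℕ → Tm L) :
    (Q.subst σ).conjuncts = Q.conjuncts.map (Query.subst σ) := by
  induction Q with
  | tru | fls | eq | atom | ex => rfl
  | and Q₁ Q₂ ih₁ ih₂ => simp [subst, conjuncts, ih₁, ih₂]

theorem mem_freeVars_iff_conjuncts {Q : Query L} {x : ℕ} :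
    x ∈ Q.freeVars ↔ ∃ C ∈ Q.conjuncts, x ∈ C.freeVars := by
  induction Q with
  | tru | fls | eq | atom | ex => simp [conjuncts]
  | and Q₁ Q₂ ih₁ ih₂ => simp [conjuncts, freeVars, ih₁, ih₂, or_and_right, exists_or]

theorem quantifierFree_iff_conjuncts {Q : Query L} :
    Q.QuantifierFree ↔ ∀ C ∈ Q.conjuncts, C.QuantifierFree := by
  induction Q with
  | tru | fls | eq | atom | ex => simp [conjuncts]
  | and Q₁ Q₂ ih₁ ih₂ =>
    simp only [conjuncts, List.forall_mem_append, ← ih₁, ← ih₂]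
    rfl

end Substitution

section Relabel

variable {Q : Query L} {f g : ℕ → ℕ}

theorem relabel_congr (h : ∀ x ∈ Q.freeVars, f x = g x) : Q.relabel f = Q.relabel g :=
  subst_congr fun x hx => congrArg Term.var (h x hx)

theorem subst_var (Q : Query L) : Q.subst Term.var = Q := by
  induction Q with
  | tru | fls => rfl
  | eq s t => simp only [subst, ← realize_eq_subst, realize_var]
  | atom A => simp only [subst, GAtom.map, ← realize_eq_subst, realize_var]
  | and Q₁ Q₂ ih₁ ih₂ => rw [subst, ih₁, ih₂]
  | ex x Q ih => rw [subst, Function.update_eq_self, ih]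

theorem relabel_eq_self (h : ∀ x ∈ Q.freeVars, f x = x) : Q.relabel f = Q :=
  (relabel_congr (g := id) h).trans Q.subst_var

theorem QuantifierFree.relabel_relabel (hQ : Q.QuantifierFree) (f g : ℕ → ℕ) :
    (Q.relabel f).relabel g = Q.relabel fun x => g (f x) :=
  hQ.subst_subst _ _

end Relabel

section BoundVariables

theorem Variant.ex {Q Q' : Query L} (h : Variant Q Q') (x : ℕ) : Variant (ex x Q) (ex x Q') :=
  Relation.ReflTransGen.lift (p := RenameStep) (Query.ex x) (fun _ _ => RenameStep.ex x) _ _ h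

variable {B : Query L} {zs : List ℕ} {ρ : ℕ → ℕ}

theorem renameStep_exs (hB : B.QuantifierFree) {z y : ℕ} (hz : z ∉ zs) (hy : y ∉ zs)
    (hyB : y ∉ B.freeVars) :
    RenameStep (ex z (exs zs B)) (ex y (exs zs (B.relabel (Function.update id z y)))) := by
  have hsingle : single (L := L) z y = fun x => Term.var (Function.update id z y x) := by
    funext x
    by_cases hx : x = z <;> simp [single, hx]
  have hfix : ∀ w ∈ zs, single (L := L) z y w = Term.var w := fun w hw =>
    Function.update_of_ne (ne_of_mem_of_not_mem hw hz) _ _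
  have hs : (exs zs B).Substitutible (single z y) := hB.substitutible_exs hfix fun w hw x hx => by
    have hwy : w ≠ y := ne_of_mem_of_not_mem hw hy
    by_cases hxz : x = z <;> simp [single, hxz, hwy, hx.symm]
  have hstep := RenameStep.here z y (exs zs B) (fun h => hyB (mem_freeVars_exs.1 h).2) hs
  rwa [subst_exs hfix, hsingle] at hstep

theorem variant_exs_of_fresh (hB : B.QuantifierFree) (hzs : zs.Nodup) (hρzs : (zs.map ρ).Nodup)
    (hfresh : ∀ z ∈ zs, ρ z ∉ zs ∧ ρ z ∉ B.freeVars) (hidem : ∀ z ∈ zs, ρ (ρ z) = ρ z)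
    (hρ : ∀ x ∈ B.freeVars, x ∉ zs → ρ x = x) :
    Variant (exs zs B) (exs (zs.map ρ) (B.relabel ρ)) := by
  induction zs generalizing B with
  | nil => rw [relabel_eq_self fun x hx => hρ x hx List.not_mem_nil]; exact .refl
  | cons z zs ih =>
    rw [List.forall_mem_cons] at hfresh hidem
    simp only [List.nodup_cons, List.map_cons, List.mem_cons, not_or] at *
    obtain ⟨⟨⟨hzz, hz⟩, hzB⟩, hfresh⟩ := hfresh
    have hsplit : (B.relabel (Function.update id z (ρ z))).relabel ρ = B.relabel ρ := by
      rw [hB.relabel_relabel]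
      refine relabel_congr fun x _ => ?_
      obtain rfl | hxz := eq_or_ne x z
      · rw [Function.update_self, hidem.1]
      · rw [Function.update_of_ne hxz, id]
    refine .head (renameStep_exs hB hzs.1 hz hzB) (Variant.ex ?_ _)
    rw [← hsplit]
    refine ih (hB.subst _) hzs.2 hρzs.2 (fun w hw => ⟨(hfresh w hw).1.2, ?_⟩) hidem.2 ?_
    · rw [hB.mem_freeVars_relabel]
      rintro ⟨x, hx, h⟩
      obtain rfl | hxz := eq_or_ne x z
      · exact hρzs.1 (List.mem_map.2 ⟨w, hw, by rw [← h, Function.update_self]⟩)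
      · rw [Function.update_of_ne hxz, id] at h
        exact (hfresh w hw).2 (h ▸ hx)
    · simp only [hB.mem_freeVars_relabel, forall_exists_index, and_imp]
      rintro _ x hx rfl hxzs
      obtain rfl | hxz := eq_or_ne x z
      · rw [Function.update_self, hidem.1]
      · rw [Function.update_of_ne hxz, id] at hxzs ⊢
        exact hρ x hx ⟨hxz, hxzs⟩

theorem mem_freeVars_shift (hB : B.QuantifierFree) {K x : ℕ}
    (hx : x ∈ (B.relabel fun x => if x ∈ zs then x + K else x).freeVars) :
    x ∈ zs.map (· + K) ∨ x ∈ B.freeVars ∧ x ∉ zs := by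
  obtain ⟨w, hw, rfl⟩ := hB.mem_freeVars_relabel.1 hx
  by_cases hwzs : w ∈ zs <;> simp [hwzs, hw]

theorem variant_exs_shift (hB : B.QuantifierFree) (hzs : zs.Nodup) {K : ℕ} (hKzs : ∀ z ∈ zs, z < K)
    (hKB : ∀ x ∈ B.freeVars, x < K) :
    Variant (exs zs B)
      (exs (zs.map (· + K)) (B.relabel fun x => if x ∈ zs then x + K else x)) := by
  set κ : ℕ → ℕ := fun x => if x ∈ zs then x + K else x
  have hκ : ∀ z ∈ zs, κ z = z + K := fun z hz => if_pos hz
  have hκ_notMem : ∀ x ∉ zs, κ x = x := fun x hx => if_neg hx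
  have hK_notMem (z : ℕ) : z + K ∉ zs := fun h => absurd (hKzs _ h) (by omega)
  rw [← List.map_congr_left hκ]
  refine variant_exs_of_fresh hB hzs ?_ (fun z hz => ?_) (fun z hz => ?_) fun x _ => hκ_notMem x
  · rw [List.map_congr_left hκ]
    exact hzs.map (add_left_injective K)
  · rw [hκ z hz]
    exact ⟨hK_notMem z, fun h => absurd (hKB _ h) (by omega)⟩
  · rw [hκ z hz, hκ_notMem _ (hK_notMem z)]

theorem variant_exs_unshift (hB : B.QuantifierFree) (hzs : zs.Nodup) {K : ℕ}
    (hKρ : ∀ z ∈ zs, ρ z < K) (hKB : ∀ x ∈ B.freeVars, x < K) (hρzs : (zs.map ρ).Nodup)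
    (hfree : ∀ x ∈ B.freeVars, x ∉ zs → x ∉ zs.map ρ) (hρ : ∀ x ∈ B.freeVars, x ∉ zs → ρ x = x) :
    Variant (exs (zs.map (· + K)) (B.relabel fun x => if x ∈ zs then x + K else x))
      (exs (zs.map ρ) (B.relabel ρ)) := by
  let μ : ℕ → ℕ := fun x => if K ≤ x then ρ (x - K) else x
  have hμ : ∀ x < K, μ x = x := fun x hx => if_neg hx.not_ge
  have hμ_add (z : ℕ) : μ (z + K) = ρ z := by simp [μ]
  have hmap : (zs.map (· + K)).map μ = zs.map ρ := by simp [hμ_add]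
  have hrelabel : (B.relabel fun x => if x ∈ zs then x + K else x).relabel μ = B.relabel ρ := by
    rw [hB.relabel_relabel]
    refine relabel_congr fun x hx => ?_
    by_cases hxzs : x ∈ zs
    · simp only [if_pos hxzs, hμ_add]
    · simp only [if_neg hxzs, hμ x (hKB x hx), hρ x hx hxzs]
  have hρ_notMem : ∀ z ∈ zs, ρ z ∉ zs.map (· + K) := fun z hz h => by
    obtain ⟨w, -, h⟩ := List.mem_map.1 h
    exact absurd (hKρ z hz) (by omega)
  rw [← hmap, ← hrelabel]
  refine variant_exs_of_fresh (hB.subst _) (hzs.map (add_left_injective K)) (hmap ▸ hρzs) ?_ ?_ ?_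
  · simp only [List.forall_mem_map, hμ_add]
    refine fun z hz => ⟨hρ_notMem z hz, fun h => ?_⟩
    obtain h | ⟨hzB, hzzs⟩ := mem_freeVars_shift hB h
    · exact hρ_notMem z hz h
    · exact hfree _ hzB hzzs (List.mem_map_of_mem hz)
  · simp only [List.forall_mem_map, hμ_add]
    exact fun z hz => hμ _ (hKρ z hz)
  · exact fun x hx hxzs => hμ x (hKB x ((mem_freeVars_shift hB hx).resolve_left hxzs).1)

theorem variant_exs (hB : B.QuantifierFree) (hzs : zs.Nodup) (hρzs : (zs.map ρ).Nodup)
    (hfree : ∀ x ∈ B.freeVars, x ∉ zs → x ∉ zs.map ρ) (hρ : ∀ x ∈ B.freeVars, x ∉ zs → ρ x = x) :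
    Variant (exs zs B) (exs (zs.map ρ) (B.relabel ρ)) := by
  obtain ⟨K, hK⟩ : ∃ K, ∀ x ∈ zs.toFinset ∪ (zs.map ρ).toFinset ∪ B.freeVars, x < K :=
    ⟨_, fun x hx => Nat.lt_succ_of_le (Finset.le_sup (f := id) hx)⟩
  simp only [Finset.mem_union, List.mem_toFinset, or_imp, forall_and, List.forall_mem_map] at hK
  obtain ⟨⟨hKzs, hKρ⟩, hKB⟩ := hK
  -- A detour through variables `≥ K`, so that no renaming captures a variable still to be renamed.
  exact (variant_exs_shift hB hzs hKzs hKB).trans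
    (variant_exs_unshift hB hzs hKρ hKB hρzs hfree hρ)

end BoundVariables

end Query

/-! ### Forms of queries -/

namespace Query

section Conjunctions

/-- The atoms occurring in a query, from left to right. -/
def atoms : Query L → List (GAtom L (Tm L))
  | atom A => [A]
  | and Q₁ Q₂ => Q₁.atoms ++ Q₂.atoms
  | ex _ Q => Q.atoms
  | _ => []

theorem length_atoms (Q : Query L) : Q.atoms.length = Q.card := by
  induction Q with
  | tru | fls | eq | atom => rfl
  | and Q₁ Q₂ ih₁ ih₂ => rw [atoms, List.length_append, ih₁, ih₂, card]
  | ex _ _ ih => exact ih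

theorem atoms_eq_flatMap_conjuncts (Q : Query L) : Q.atoms = Q.conjuncts.flatMap atoms := by
  induction Q with
  | tru | fls | eq | atom | ex => simp [conjuncts]
  | and Q₁ Q₂ ih₁ ih₂ => rw [atoms, conjuncts, List.flatMap_append, ← ih₁, ← ih₂]

theorem conjuncts_ne_nil (Q : Query L) : Q.conjuncts ≠ [] := by
  induction Q with
  | tru | fls | eq | atom | ex => exact List.cons_ne_nil _ _
  | and _ _ ih₁ _ => exact List.append_ne_nil_of_left_ne_nil ih₁ _

theorem card_exs (zs : List ℕ) (Q : Query L) : (exs zs Q).card = Q.card := by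
  induction zs with
  | nil => rfl
  | cons _ _ ih => exact ih

variable {J : Type*} [(fnPart L).Structure J] {Q : Query L} {h : ℕ → J} {Is : List (Interp L J)}

theorem mem_sol_exs {zs : List ℕ} :
    h ∈ (exs zs Q).sol J Is ↔ ∃ g, (∀ x ∉ zs, g x = h x) ∧ g ∈ Q.sol J Is := by
  induction zs generalizing h with
  | nil => simp [exs, ← funext_iff]
  | cons z zs ih =>
    change (∃ d, Function.update h z d ∈ (exs zs Q).sol J Is) ↔ _
    simp only [ih, List.mem_cons, not_or, and_imp]
    constructor
    · rintro ⟨d, g, hg, hgQ⟩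
      exact ⟨g, fun x hxz hx => by rw [hg x hx, Function.update_of_ne hxz], hgQ⟩
    · rintro ⟨g, hg, hgQ⟩
      refine ⟨g z, g, fun x hx => ?_, hgQ⟩
      obtain rfl | hxz := eq_or_ne x z
      · rw [Function.update_self]
      · rw [Function.update_of_ne hxz, hg x hxz hx]

theorem QuantifierFree.mem_sol_iff (hQ : Q.QuantifierFree) (hIs : Is.length = Q.card) :
    h ∈ Q.sol J Is ↔ fls ∉ Q.conjuncts ∧
      (∀ s t, eq s t ∈ Q.conjuncts → s.realize h = t.realize h) ∧ AtomsSat h Q.atoms Is := by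
  induction Q generalizing Is with
  | tru | fls | eq =>
    obtain rfl := List.eq_nil_of_length_eq_zero hIs
    simp [sol, conjuncts, atoms, AtomsSat]
  | atom A =>
    obtain ⟨I, rfl⟩ := List.length_eq_one_iff.1 hIs
    simp [sol, conjuncts, atoms, AtomsSat]
  | and Q₁ Q₂ ih₁ ih₂ =>
    simp only [card] at hIs
    rw [sol, Set.mem_inter_iff, ih₁ hQ.1 (by simp [hIs]), ih₂ hQ.2 (by simp [hIs]), atoms,
      atomsSat_append, length_atoms]
    simp only [conjuncts, List.mem_append, not_or, or_imp, forall_and]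
    tauto
  | ex => exact hQ.elim

end Conjunctions

section HasForm

variable {Q B : Query L} {zs : List ℕ} {eqs : List (ℕ × Tm L)} {as : List (GAtom L (Tm L))}

theorem atoms_of_conjuncts_eq
    (hB : B.conjuncts = eqs.map (fun e => eq (Term.var e.1) e.2) ++ as.map atom) :
    B.atoms = as := by
  rw [atoms_eq_flatMap_conjuncts, hB]
  simp [List.flatMap_map, atoms]

theorem quantifierFree_of_conjuncts_eq
    (hB : B.conjuncts = eqs.map (fun e => eq (Term.var e.1) e.2) ++ as.map atom) :
    B.QuantifierFree := by
  rw [quantifierFree_iff_conjuncts, hB]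
  simp only [List.forall_mem_append, List.forall_mem_map]
  exact ⟨fun _ _ => trivial, fun _ _ => trivial⟩

variable {J : Type*} [(fnPart L).Structure J] {h : ℕ → J} {Is : List (Interp L J)}

theorem HasForm.mem_sol_iff (hQ : Q.HasForm zs eqs as) (hIs : Is.length = Q.card) :
    h ∈ Q.sol J Is ↔ ∃ g : ℕ → J, (∀ x ∉ zs, g x = h x) ∧
      (∀ e ∈ eqs, g e.1 = e.2.realize g) ∧ AtomsSat g as Is := by
  obtain ⟨B, rfl, hB⟩ := hQ
  rw [card_exs] at hIs
  have heqs (g : ℕ → J) : (∀ s t, eq s t ∈ B.conjuncts → s.realize g = t.realize g) ↔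
      ∀ e ∈ eqs, g e.1 = e.2.realize g := by
    have hmem (s t : Tm L) : eq s t ∈ B.conjuncts ↔ ∃ e ∈ eqs, Term.var e.1 = s ∧ e.2 = t := by
      simp [hB]
    simp only [hmem]
    exact ⟨fun heqs e he => heqs _ _ ⟨e, he, rfl, rfl⟩, fun heqs _ _ ⟨e, he, hs, ht⟩ =>
      hs ▸ ht ▸ heqs e he⟩
  rw [mem_sol_exs]
  simp only [(quantifierFree_of_conjuncts_eq hB).mem_sol_iff hIs, atoms_of_conjuncts_eq hB, heqs]
  simp [hB]

end HasForm

end Query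

section Tag

/-- A variable, classified as bound by the quantifier prefix `zs` or as free. -/
def tag (zs : List ℕ) (x : ℕ) : ℕ ⊕ {z // z ∈ zs} :=
  if hx : x ∈ zs then Sum.inr ⟨x, hx⟩ else Sum.inl x

/-- The inverse of `tag`. -/
def untag (zs : List ℕ) : ℕ ⊕ {z // z ∈ zs} → ℕ :=
  Sum.elim id Subtype.val

variable {zs : List ℕ} {x : ℕ} {t : Tm L}

theorem tag_of_notMem (hx : x ∉ zs) : tag zs x = Sum.inl x :=
  dif_neg hx

theorem tag_of_mem (hx : x ∈ zs) : tag zs x = Sum.inr ⟨x, hx⟩ :=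
  dif_pos hx

theorem untag_comp_tag (zs : List ℕ) : untag zs ∘ tag zs = id := by
  funext x
  by_cases hx : x ∈ zs <;> simp [untag, tag, hx]

theorem inl_mem_varFinset_relabel_tag :
    Sum.inl x ∈ (t.relabel (tag zs)).varFinset ↔ x ∈ t.varFinset ∧ x ∉ zs := by
  rw [mem_varFinset_relabel]
  constructor
  · rintro ⟨y, hy, hyx⟩
    by_cases hyzs : y ∈ zs
    · simp [tag_of_mem hyzs] at hyx
    · obtain rfl : y = x := by simpa [tag_of_notMem hyzs] using hyx
      exact ⟨hy, hyzs⟩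
  · exact fun hx => ⟨x, hx.1, tag_of_notMem hx.2⟩

theorem inr_mem_varFinset_relabel_tag {z : {z // z ∈ zs}} :
    Sum.inr z ∈ (t.relabel (tag zs)).varFinset ↔ z.1 ∈ t.varFinset := by
  rw [mem_varFinset_relabel]
  constructor
  · rintro ⟨y, hy, hyz⟩
    by_cases hyzs : y ∈ zs
    · obtain rfl : ⟨y, hyzs⟩ = z := by simpa [tag_of_mem hyzs] using hyz
      exact hy
    · simp [tag_of_notMem hyzs] at hyz
  · exact fun hz => ⟨z, hz, tag_of_mem z.2⟩

end Tag

namespace Form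

variable {zs : List ℕ} {eqs : List (ℕ × Tm L)} {as : List (GAtom L (Tm L))}

/-- The form of the query `∃ zs, eqs ∧ as`. -/
def ofLists (zs : List ℕ) (eqs : List (ℕ × Tm L)) (as : List (GAtom L (Tm L))) :
    Form L ℕ {z // z ∈ zs} :=
  ⟨eqs.map (Prod.map id (Term.relabel (tag zs))), as.map (GAtom.map (Term.relabel (tag zs)))⟩

variable {J : Type*} [(fnPart L).Structure J] {h : ℕ → J} {Is : List (Interp L J)}

theorem sat_ofLists (hzs : ∀ e ∈ eqs, e.1 ∉ zs) :
    (ofLists zs eqs as).Sat h Is ↔ ∃ g : ℕ → J, (∀ x ∉ zs, g x = h x) ∧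
      (∀ e ∈ eqs, g e.1 = e.2.realize g) ∧ AtomsSat g as Is := by
  have hrelabel (k : {z // z ∈ zs} → J) :
      AtomsSat (Sum.elim h k) (as.map (GAtom.map (Term.relabel (tag zs)))) Is ↔
        AtomsSat (Sum.elim h k ∘ tag zs) as Is := by
    simp only [← funext fun t : Tm L => realize_var_comp t (tag zs), atomsSat_map]
    rfl
  simp only [Sat, ofLists, List.forall_mem_map, Prod.map, id, Term.realize_relabel, hrelabel]
  constructor
  · rintro ⟨k, heqs, has⟩
    refine ⟨Sum.elim h k ∘ tag zs, fun x hx => by simp [tag_of_notMem hx], fun e he => ?_, has⟩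
    rw [← heqs e he]
    simp [tag_of_notMem (hzs e he)]
  · rintro ⟨g, hg, heqs, has⟩
    have hgk : Sum.elim h (fun z => g z.1) ∘ tag zs = g := by
      funext x
      by_cases hx : x ∈ zs
      · simp [tag_of_mem hx]
      · simp [tag_of_notMem hx, hg x hx]
    refine ⟨fun z => g z.1, fun e he => ?_, hgk.symm ▸ has⟩
    rw [hgk, ← heqs e he, hg _ (hzs e he)]

theorem mem_terms_ofLists {t : (fnPart L).Term (ℕ ⊕ {z // z ∈ zs})} :
    t ∈ (ofLists zs eqs as).terms ↔
      (∃ e ∈ eqs, e.2.relabel (tag zs) = t) ∨ ∃ A ∈ as, ∃ i, (A.args i).relabel (tag zs) = t := by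
  simp [terms, ofLists, GAtom.map]

theorem heads_ofLists : (ofLists zs eqs as).heads = eqs.map Prod.fst := by
  simp [heads, ofLists, Function.comp_def]

theorem isSolved_ofLists (hnodup : (eqs.map Prod.fst).Nodup)
    (hheads : ∀ x ∈ eqs.map Prod.fst,
      (∀ e ∈ eqs, x ∉ e.2.varFinset) ∧ ∀ A ∈ as, x ∉ A.vars)
    (hzs : ∀ z ∈ zs, (∃ e ∈ eqs, z ∈ e.2.varFinset) ∨ ∃ A ∈ as, z ∈ A.vars)
    (hne : ∀ z ∈ zs, ∀ e ∈ eqs, e.2 ≠ Term.var z) : (ofLists zs eqs as).IsSolved where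
  nodup_heads := heads_ofLists ▸ hnodup
  head_notMem x hx t ht hxt := by
    rw [heads_ofLists] at hx
    obtain ⟨e, he, rfl⟩ | ⟨A, hA, i, rfl⟩ := mem_terms_ofLists.1 ht
    · exact (hheads x hx).1 e he (inl_mem_varFinset_relabel_tag.1 hxt).1
    · exact (hheads x hx).2 A hA (GAtom.mem_vars.2 ⟨i, (inl_mem_varFinset_relabel_tag.1 hxt).1⟩)
  exists_mem z := by
    obtain ⟨e, he, hz⟩ | ⟨A, hA, hz⟩ := hzs z z.2
    · exact ⟨_, mem_terms_ofLists.2 (Or.inl ⟨e, he, rfl⟩), inr_mem_varFinset_relabel_tag.2 hz⟩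
    · obtain ⟨i, hi⟩ := GAtom.mem_vars.1 hz
      exact ⟨_, mem_terms_ofLists.2 (Or.inr ⟨A, hA, i, rfl⟩), inr_mem_varFinset_relabel_tag.2 hi⟩
  ne_var := List.forall_mem_map.2 fun e he z heq => hne z z.2 e he <| by
    have h := congrArg (Term.relabel (untag zs)) heq
    rwa [Prod.map_snd, Term.relabel_relabel, untag_comp_tag, Term.relabel_id] at h

end Form

namespace Query

section NormalForm

variable {Q Q' : Query L} {zs zs' : List ℕ} {eqs eqs' : List (ℕ × Tm L)}
  {as as' : List (GAtom L (Tm L))}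

/-- `Q` is `∃ zs, eqs ∧ as` up to bracketing, where `TRUE` counts as the empty conjunction. -/
def HasNormalForm (Q : Query L) (zs : List ℕ) (eqs : List (ℕ × Tm L))
    (as : List (GAtom L (Tm L))) : Prop :=
  Q.HasForm zs eqs as ∨ Q = tru ∧ zs = [] ∧ eqs = [] ∧ as = []

theorem Solved.eq_fls_or_hasNormalForm (hQ : Q.Solved) :
    Q = fls ∨ ∃ zs eqs as, Q.HasNormalForm zs eqs as ∧ (eqs.map Prod.fst ++ zs).Nodup ∧
      (Form.ofLists zs eqs as).IsSolved := by
  obtain rfl | rfl | ⟨zs, eqs, as, hform, hnodup, hheads, hzs, hne⟩ := hQ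
  · refine Or.inr ⟨[], [], [], Or.inr ⟨rfl, rfl, rfl, rfl⟩, List.nodup_nil, ?_⟩
    exact Form.isSolved_ofLists List.nodup_nil (by simp) (by simp) (by simp)
  · exact Or.inl rfl
  · exact Or.inr ⟨zs, eqs, as, Or.inl hform, hnodup,
      Form.isSolved_ofLists (List.nodup_append'.1 hnodup).1 hheads hzs hne⟩

theorem HasNormalForm.card_eq (hQ : Q.HasNormalForm zs eqs as) : Q.card = as.length := by
  obtain ⟨B, rfl, hB⟩ | ⟨rfl, -, -, rfl⟩ := hQ
  · rw [card_exs, ← length_atoms, atoms_of_conjuncts_eq hB]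
  · rfl

theorem HasNormalForm.eq_tru (hQ : Q.HasNormalForm zs [] []) : Q = tru := by
  obtain ⟨B, -, hB⟩ | ⟨rfl, -⟩ := hQ
  · exact absurd hB B.conjuncts_ne_nil
  · rfl

variable {J : Type*} [(fnPart L).Structure J] {h : ℕ → J} {Is : List (Interp L J)}

theorem HasNormalForm.mem_sol_iff (hQ : Q.HasNormalForm zs eqs as)
    (hnodup : (eqs.map Prod.fst ++ zs).Nodup) (hIs : Is.length = Q.card) :
    h ∈ Q.sol J Is ↔ (Form.ofLists zs eqs as).Sat h Is := by
  have hzs : ∀ e ∈ eqs, e.1 ∉ zs := fun e he =>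
    List.disjoint_of_nodup_append hnodup (List.mem_map_of_mem he)
  rw [Form.sat_ofLists hzs]
  obtain hQ | ⟨rfl, rfl, rfl, rfl⟩ := hQ
  · exact hQ.mem_sol_iff hIs
  · obtain rfl := List.eq_nil_of_length_eq_zero hIs
    exact iff_of_true trivial ⟨h, by simp [AtomsSat]⟩

theorem LeJ.sat (hle : LeJ J Q Q') (hQ : Q.HasNormalForm zs eqs as)
    (hnodup : (eqs.map Prod.fst ++ zs).Nodup) (hQ' : Q'.HasNormalForm zs' eqs' as')
    (hnodup' : (eqs'.map Prod.fst ++ zs').Nodup) (hsat : (Form.ofLists zs eqs as).Sat h Is) :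
    (Form.ofLists zs' eqs' as').Sat h Is := by
  have hIs : Is.length = Q.card := by
    rw [hQ.card_eq]
    obtain ⟨k, -, has⟩ := hsat
    exact has.length_eq.symm.trans (List.length_map _)
  rw [← hQ'.mem_sol_iff hnodup' (hIs.trans hle.1)]
  exact hle.2 Is hIs ((hQ.mem_sol_iff hnodup hIs).2 hsat)

theorem HasNormalForm.not_leJ_fls (hQ : Q.HasNormalForm zs eqs as)
    (hnodup : (eqs.map Prod.fst ++ zs).Nodup) (hS : (Form.ofLists zs eqs as).IsSolved) :
    ¬ LeJ ((fnPart L).Term (ℕ ⊕ {z // z ∈ zs})) Q fls := fun hle =>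
  hle.2 _ (by simp [hQ.card_eq, Form.ofLists]) ((hQ.mem_sol_iff hnodup
    (by simp [hQ.card_eq, Form.ofLists])).2 hS.sat_value)

end NormalForm

end Query

namespace Form

section FreeVars

variable {α β β' : Type*} [DecidableEq α] [DecidableEq β] [DecidableEq β']

/-- The free variables of a form. -/
def freeVars (S : Form L α β) : Set α :=
  {x | x ∈ S.heads ∨ ∃ t ∈ S.terms, Sum.inl x ∈ t.varFinset}

theorem apply_mem_freeVars_relabel {S : Form L α β} {x : α} (hx : x ∈ S.freeVars) (f : α → α)
    (e : β → β') : f x ∈ (S.relabel f e).freeVars := by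
  obtain hx | ⟨t, ht, hx⟩ := hx
  · obtain ⟨q, hq, rfl⟩ := List.mem_map.1 hx
    exact Or.inl (List.mem_map.2 ⟨_, List.mem_map_of_mem hq, rfl⟩)
  · refine Or.inr ⟨t.relabel (Sum.map f e), ?_, mem_varFinset_relabel.2 ⟨_, hx, rfl⟩⟩
    obtain ⟨q, hq, rfl⟩ | ⟨A, hA, i, rfl⟩ := ht
    · exact Or.inl ⟨_, List.mem_map_of_mem hq, rfl⟩
    · exact Or.inr ⟨_, List.mem_map_of_mem hA, i, rfl⟩

theorem freeVars_subset {S S' : Form L α β} (heqs : S.eqs ⊆ S'.eqs)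
    (hatoms : S.atoms ⊆ S'.atoms) : S.freeVars ⊆ S'.freeVars := by
  rintro x (hx | ⟨t, ht, hx⟩)
  · exact Or.inl (List.map_subset _ heqs hx)
  · exact Or.inr ⟨t, ht.imp (fun ⟨q, hq, h⟩ => ⟨q, heqs hq, h⟩)
      fun ⟨A, hA, h⟩ => ⟨A, hatoms hA, h⟩, hx⟩

end FreeVars

section OfLists

variable {zs zs' : List ℕ} {eqs eqs' : List (ℕ × Tm L)} {as as' : List (GAtom L (Tm L))} {x : ℕ}

theorem notMem_of_mem_freeVars_ofLists (hnodup : (eqs.map Prod.fst ++ zs).Nodup)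
    (hx : x ∈ (ofLists zs eqs as).freeVars) : x ∉ zs := by
  obtain hx | ⟨t, ht, hx⟩ := hx
  · exact List.disjoint_of_nodup_append hnodup (heads_ofLists ▸ hx)
  · obtain ⟨q, -, rfl⟩ | ⟨A, -, i, rfl⟩ := mem_terms_ofLists.1 ht <;>
    exact (inl_mem_varFinset_relabel_tag.1 hx).2

theorem mem_eqs_of_mem_eqs_ofLists {y : ℕ}
    (h : (x, Term.var (Sum.inl y)) ∈ (ofLists zs eqs as).eqs) : (x, Term.var y) ∈ eqs := by
  obtain ⟨⟨x, t⟩, ht, heq⟩ := List.mem_map.1 h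
  simp only [Prod.map, id, Prod.mk.injEq] at heq
  obtain ⟨rfl, heq⟩ := heq
  have huntag := congrArg (Term.relabel (untag zs)) heq
  rw [Term.relabel_relabel, untag_comp_tag, Term.relabel_id] at huntag
  obtain rfl : t = Term.var y := huntag
  exact ht

theorem eqs_perm_of_relabel_ofLists {f : ℕ → ℕ} {e : {z // z ∈ zs} → {z // z ∈ zs'}}
    (h : ((ofLists zs eqs as).relabel f e).eqs.Perm (ofLists zs' eqs' as').eqs) :
    (eqs.map (Prod.map f (Term.relabel (untag zs' ∘ Sum.map f e ∘ tag zs)))).Perm eqs' := by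
  have huntag := h.map (Prod.map id (Term.relabel (untag zs')))
  simpa only [relabel, ofLists, List.map_map, Prod.map_comp_map, Term.relabel_comp_relabel,
    untag_comp_tag, Function.id_comp, Function.comp_id, Term.relabel_id_eq_id, Prod.map_id,
    List.map_id] using huntag

theorem atoms_eq_of_relabel_ofLists {f : ℕ → ℕ} {e : {z // z ∈ zs} → {z // z ∈ zs'}}
    (h : ((ofLists zs eqs as).relabel f e).atoms = (ofLists zs' eqs' as').atoms) :
    as.map (GAtom.map (Term.relabel (untag zs' ∘ Sum.map f e ∘ tag zs))) = as' := by
  have hcomp {X Y Z : Type u} (f : Y → Z) (g : X → Y) :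
      GAtom.map (L := L) f ∘ GAtom.map g = GAtom.map (f ∘ g) := rfl
  have hid : GAtom.map (L := L) (id : Tm L → Tm L) = id := rfl
  have huntag := congrArg (List.map (GAtom.map (Term.relabel (untag zs')))) h
  simpa only [relabel, ofLists, List.map_map, hcomp, Term.relabel_comp_relabel,
    untag_comp_tag, Function.id_comp, Function.comp_id, Term.relabel_id_eq_id, hid,
    List.map_id] using huntag

end OfLists

end Form

namespace Query

variable {Q Q' B : Query L} {zs zs' : List ℕ} {eqs eqs' : List (ℕ × Tm L)}
  {as as' : List (GAtom L (Tm L))}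

theorem HasForm.mem_freeVars (hQ : Q.HasForm zs eqs as) {x : ℕ} (hx : x ∈ Q.freeVars) :
    x ∈ (Form.ofLists zs eqs as).freeVars := by
  obtain ⟨B, rfl, hB⟩ := hQ
  rw [mem_freeVars_exs, mem_freeVars_iff_conjuncts, hB] at hx
  obtain ⟨hxzs, C, hC, hxC⟩ := hx
  obtain hC | hC := List.mem_append.1 hC
  · obtain ⟨q, hq, rfl⟩ := List.mem_map.1 hC
    simp only [freeVars, Term.varFinset, Finset.mem_union, Finset.mem_singleton] at hxC
    obtain rfl | hx := hxC
    · exact Or.inl (Form.heads_ofLists ▸ List.mem_map_of_mem hq)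
    · exact Or.inr ⟨_, Form.mem_terms_ofLists.2 (Or.inl ⟨q, hq, rfl⟩),
        inl_mem_varFinset_relabel_tag.2 ⟨hx, hxzs⟩⟩
  · obtain ⟨A, hA, rfl⟩ := List.mem_map.1 hC
    obtain ⟨i, hi⟩ := GAtom.mem_vars.1 hxC
    exact Or.inr ⟨_, Form.mem_terms_ofLists.2 (Or.inr ⟨A, hA, i, rfl⟩),
      inl_mem_varFinset_relabel_tag.2 ⟨hi, hxzs⟩⟩

theorem swap_eq_var_swapVar (ps : List (ℕ × ℕ)) :
    swap (L := L) ps = fun x => Term.var (swapVar ps x) := by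
  induction ps with
  | nil => rfl
  | cons p ps ih =>
    funext x
    simp only [swap, swapVar, ih, Function.update_apply]
    split_ifs <;> rfl

theorem conjuncts_relabel
    (hB : B.conjuncts = eqs.map (fun q => eq (Term.var q.1) q.2) ++ as.map atom) (f : ℕ → ℕ) :
    (B.relabel f).conjuncts = (eqs.map (Prod.map f (Term.relabel f))).map
        (fun q => eq (Term.var q.1) q.2) ++ (as.map (GAtom.map (Term.relabel f))).map atom := by
  rw [relabel, conjuncts_subst, hB]
  simp [Function.comp_def, subst, ← realize_eq_subst, realize_var_comp]

end Query

/-! ### Isomorphism -/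

section RenameAlong

variable {zs zs' : List ℕ}

/-- The renaming of the bound variables `zs` along a bijection with the bound variables `zs'`. -/
def renameAlong (e : {z // z ∈ zs} ≃ {z // z ∈ zs'}) (x : ℕ) : ℕ :=
  if hx : x ∈ zs then e ⟨x, hx⟩ else x

variable (e : {z // z ∈ zs} ≃ {z // z ∈ zs'})

theorem renameAlong_of_mem {x : ℕ} (hx : x ∈ zs) : renameAlong e x = e ⟨x, hx⟩ :=
  dif_pos hx

theorem renameAlong_of_notMem {x : ℕ} (hx : x ∉ zs) : renameAlong e x = x :=
  dif_neg hx

theorem nodup_map_renameAlong (hzs : zs.Nodup) : (zs.map (renameAlong e)).Nodup := by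
  refine hzs.map_on fun x hx y hy h => ?_
  rw [renameAlong_of_mem e hx, renameAlong_of_mem e hy] at h
  exact congrArg Subtype.val (e.injective (Subtype.ext h))

theorem map_renameAlong_perm (hzs : zs.Nodup) (hzs' : zs'.Nodup) :
    (zs.map (renameAlong e)).Perm zs' := by
  refine (List.perm_ext_iff_of_nodup (nodup_map_renameAlong e hzs) hzs').2 fun y => ?_
  rw [List.mem_map]
  constructor
  · rintro ⟨x, hx, rfl⟩
    exact renameAlong_of_mem e hx ▸ (e ⟨x, hx⟩).2
  · intro hy
    obtain ⟨⟨x, hx⟩, he⟩ := e.surjective ⟨y, hy⟩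
    exact ⟨x, hx, by rw [renameAlong_of_mem e hx, he]⟩

theorem untag_comp_map_comp_tag {f : ℕ → ℕ} (hf : ∀ z ∈ zs, f z = z) (hfzs : ∀ x ∉ zs, f x ∉ zs) :
    untag zs' ∘ Sum.map f e ∘ tag zs = fun x => renameAlong e (f x) := by
  funext x
  by_cases hx : x ∈ zs
  · simp [tag_of_mem hx, hf x hx, renameAlong_of_mem e hx, untag]
  · simp [tag_of_notMem hx, renameAlong_of_notMem e (hfzs x hx), untag]

end RenameAlong

namespace Query

section Isomorphism

variable {Q Q' B : Query L} {zs zs' : List ℕ} {eqs eqs' : List (ℕ × Tm L)}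
  {as as' : List (GAtom L (Tm L))}

variable {ps : List (ℕ × ℕ)}

theorem swapVar_eq_self (hps : ∀ p ∈ ps, p.1 ∉ zs ∧ p.2 ∉ zs) {z : ℕ} (hz : z ∈ zs) :
    swapVar ps z = z := by
  refine swapVar_of_notMem (fun h => ?_) fun h => ?_ <;> obtain ⟨p, hp, rfl⟩ := List.mem_map.1 h
  exacts [(hps p hp).1 hz, (hps p hp).2 hz]

theorem redirectStep_exs
    (hB : B.conjuncts = eqs.map (fun q => eq (Term.var q.1) q.2) ++ as.map atom)
    (heqs : ∀ p ∈ ps, (p.1, Term.var p.2) ∈ eqs)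
    (hnodup : (ps.map Prod.fst ++ ps.map Prod.snd).Nodup)
    (hps : ∀ p ∈ ps, p.1 ∉ zs ∧ p.2 ∉ zs) :
    RedirectStep (exs zs B) (exs zs (B.relabel (swapVar ps))) := by
  have hfix : ∀ z ∈ zs, swap (L := L) ps z = Term.var z := fun z hz => by
    simp only [swap_eq_var_swapVar, swapVar_eq_self hps hz]
  refine ⟨zs, eqs, as, ps, ⟨B, rfl, hB⟩, heqs, hnodup,
    (quantifierFree_of_conjuncts_eq hB).substitutible_exs hfix fun z hz x hxz h => hxz ?_, ?_⟩
  · rw [swap_eq_var_swapVar, Term.varFinset, Finset.mem_singleton] at h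
    exact (swapVar_involutive hnodup).injective (h.symm.trans (swapVar_eq_self hps hz).symm)
  · rw [subst_exs hfix, swap_eq_var_swapVar, relabel]

theorem permStep_renameAlong
    (hB : B.conjuncts = eqs.map (fun q => eq (Term.var q.1) q.2) ++ as.map atom)
    (hQ' : Q'.HasForm zs' eqs' as') (hzs : zs.Nodup) (hzs' : zs'.Nodup) {f : ℕ → ℕ}
    (hf : ∀ z ∈ zs, f z = z) (hfzs : ∀ x ∉ zs, f x ∉ zs) (hheads : ∀ q ∈ eqs, q.1 ∉ zs)
    {e : {z // z ∈ zs} ≃ {z // z ∈ zs'}}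
    (heqs : ((Form.ofLists zs eqs as).relabel f e).eqs.Perm (Form.ofLists zs' eqs' as').eqs)
    (hatoms : ((Form.ofLists zs eqs as).relabel f e).atoms = (Form.ofLists zs' eqs' as').atoms) :
    PermStep (exs (zs.map (renameAlong e)) ((B.relabel f).relabel (renameAlong e))) Q' := by
  replace heqs := Form.eqs_perm_of_relabel_ofLists heqs
  replace hatoms := Form.atoms_eq_of_relabel_ofLists hatoms
  rw [untag_comp_map_comp_tag e hf hfzs] at heqs hatoms
  have hconj := conjuncts_relabel hB fun x => renameAlong e (f x)
  have hmap : eqs.map (Prod.map (fun x => renameAlong e (f x))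
        (Term.relabel fun x => renameAlong e (f x))) =
      eqs.map (Prod.map f (Term.relabel fun x => renameAlong e (f x))) :=
    List.map_congr_left fun q hq =>
      congrArg (·, _) (renameAlong_of_notMem e (hfzs q.1 (hheads q hq)))
  rw [hatoms, hmap, ← (quantifierFree_of_conjuncts_eq hB).relabel_relabel] at hconj
  exact ⟨_, zs', _, eqs', as', ⟨_, rfl, hconj⟩, hQ', map_renameAlong_perm e hzs hzs', heqs⟩

theorem HasForm.isomorphic (hsolved : Q.Solved) (hQ : Q.HasForm zs eqs as)
    (hQ' : Q'.HasForm zs' eqs' as') (hnodup : (eqs.map Prod.fst ++ zs).Nodup)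
    (hnodup' : (eqs'.map Prod.fst ++ zs').Nodup)
    (hps : ∀ p ∈ ps, (p.1, Term.var (Sum.inl p.2)) ∈ (Form.ofLists zs eqs as).eqs)
    (hps_nodup : (ps.map Prod.fst ++ ps.map Prod.snd).Nodup)
    {e : {z // z ∈ zs} ≃ {z // z ∈ zs'}}
    (heqs : ((Form.ofLists zs eqs as).relabel (swapVar ps) e).eqs.Perm
      (Form.ofLists zs' eqs' as').eqs)
    (hatoms : ((Form.ofLists zs eqs as).relabel (swapVar ps) e).atoms =
      (Form.ofLists zs' eqs' as').atoms) : Isomorphic Q Q' := by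
  obtain ⟨B, rfl, hB⟩ := hQ
  have hBfree := quantifierFree_of_conjuncts_eq hB
  have hzs := (List.nodup_append'.1 hnodup).2.1
  have hzs' := (List.nodup_append'.1 hnodup').2.1
  have hps_zs : ∀ p ∈ ps, p.1 ∉ zs ∧ p.2 ∉ zs := fun p hp =>
    ⟨Form.notMem_of_mem_freeVars_ofLists hnodup (Or.inl (List.mem_map_of_mem (hps p hp))),
      Form.notMem_of_mem_freeVars_ofLists hnodup (Or.inr ⟨_, Or.inl ⟨_, hps p hp, rfl⟩, by simp⟩)⟩
  have hf : ∀ z ∈ zs, swapVar ps z = z := fun z => swapVar_eq_self hps_zs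
  have hinv := swapVar_involutive hps_nodup
  have hfzs : ∀ x ∉ zs, swapVar ps x ∉ zs := fun x hx h => hx (hinv.injective (hf _ h) ▸ h)
  have hheads : ∀ q ∈ eqs, q.1 ∉ zs := fun q hq =>
    List.disjoint_of_nodup_append hnodup (List.mem_map_of_mem hq)
  have hfree : ∀ x ∈ (B.relabel (swapVar ps)).freeVars, x ∉ zs → x ∉ zs' := fun x hx hxzs => by
    obtain ⟨y, hy, rfl⟩ := hBfree.mem_freeVars_relabel.1 hx
    have hyzs : y ∉ zs := fun h => hxzs ((hf y h).symm ▸ h)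
    have hmem := Form.apply_mem_freeVars_relabel (HasForm.mem_freeVars ⟨B, rfl, hB⟩
      (mem_freeVars_exs.2 ⟨hyzs, hy⟩)) (swapVar ps) e
    exact Form.notMem_of_mem_freeVars_ofLists hnodup'
      (Form.freeVars_subset heqs.subset (hatoms ▸ List.Subset.refl _) hmem)
  have hredirect := redirectStep_exs hB
    (fun p hp => Form.mem_eqs_of_mem_eqs_ofLists (hps p hp)) hps_nodup hps_zs
  have hvariant := variant_exs (ρ := renameAlong e) (hBfree.subst _) hzs
    (nodup_map_renameAlong e hzs)
    (fun x hx hxzs h => hfree x hx hxzs ((map_renameAlong_perm e hzs hzs').subset h))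
    fun x _ => renameAlong_of_notMem e
  have hperm := permStep_renameAlong hB hQ' hzs hzs' hf hfzs hheads heqs hatoms
  exact ⟨hsolved, .head (Or.inr (Or.inr hredirect)) (.head (Or.inr (Or.inl hvariant))
    (.single (Or.inl hperm)))⟩

theorem HasNormalForm.isomorphic (hsolved : Q.Solved) (hQ : Q.HasNormalForm zs eqs as)
    (hQ' : Q'.HasNormalForm zs' eqs' as') (hnodup : (eqs.map Prod.fst ++ zs).Nodup)
    (hnodup' : (eqs'.map Prod.fst ++ zs').Nodup) (hS : (Form.ofLists zs eqs as).IsSolved)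
    (hS' : (Form.ofLists zs' eqs' as').IsSolved)
    (hle : LeJ ((fnPart L).Term (ℕ ⊕ {z // z ∈ zs})) Q Q')
    (hge : LeJ ((fnPart L).Term (ℕ ⊕ {z // z ∈ zs'})) Q' Q) : Isomorphic Q Q' := by
  obtain ⟨ps, e, hps, hps_nodup, heqs, hatoms⟩ := hS.exists_relabel_perm hS'
    (fun _ _ => hle.sat hQ hnodup hQ' hnodup') fun _ _ => hge.sat hQ' hnodup' hQ hnodup
  have heqs_length : eqs.length = eqs'.length := by
    simpa [Form.relabel, Form.ofLists] using heqs.length_eq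
  have hatoms_length : as.length = as'.length := by
    simpa [Form.relabel, Form.ofLists] using congrArg List.length hatoms
  obtain ⟨hform, hform'⟩ | ⟨heqs_nil, hatoms_nil⟩ : (Q.HasForm zs eqs as ∧
      Q'.HasForm zs' eqs' as') ∨ eqs = [] ∧ as = [] := by
    obtain hQ | ⟨-, -, rfl, rfl⟩ := hQ
    · obtain hQ' | ⟨-, -, rfl, rfl⟩ := hQ'
      · exact Or.inl ⟨hQ, hQ'⟩
      · exact Or.inr ⟨List.length_eq_zero_iff.1 heqs_length,
          List.length_eq_zero_iff.1 hatoms_length⟩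
    · exact Or.inr ⟨rfl, rfl⟩
  · exact hform.isomorphic hsolved hform' hnodup hnodup' hps hps_nodup heqs hatoms
  · subst heqs_nil hatoms_nil
    obtain rfl := List.length_eq_zero_iff.1 heqs_length.symm
    obtain rfl := List.length_eq_zero_iff.1 hatoms_length.symm
    rw [hQ.eq_tru] at hsolved ⊢
    rw [hQ'.eq_tru]
    exact ⟨hsolved, .refl⟩

theorem Solved.isomorphic (hQ : Q.Solved) (hQ' : Q'.Solved)
    (hequiv : ∀ zs : List ℕ, EquivJ ((fnPart L).Term (ℕ ⊕ {z // z ∈ zs})) Q Q') :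
    Isomorphic Q Q' := by
  have hle zs := (equivJ_iff.1 (hequiv zs)).1
  have hge zs := (equivJ_iff.1 (hequiv zs)).2
  obtain rfl | ⟨zs, eqs, as, hform, hnodup, hS⟩ := hQ.eq_fls_or_hasNormalForm <;>
    obtain rfl | ⟨zs', eqs', as', hform', hnodup', hS'⟩ := hQ'.eq_fls_or_hasNormalForm
  · exact ⟨hQ, .refl⟩
  · exact absurd (hge zs') (hform'.not_leJ_fls hnodup' hS')
  · exact absurd (hle zs) (hform.not_leJ_fls hnodup hS)
  · exact hform.isomorphic hQ hform' hnodup hnodup' hS hS' (hle zs) (hge zs')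

theorem Equivalent.isomorphic (hL : Nonempty (L.Functions 0))
    (h : Equivalent.{u, v, max u w'} Q Q') (hQ : Q.Solved) (hQ' : Q'.Solved) :
    Isomorphic Q Q' :=
  hQ.isomorphic hQ' fun zs =>
    have : Nontrivial ((fnPart L).Term (ℕ ⊕ {z // z ∈ zs})) :=
      ⟨Term.var (Sum.inl 0), Term.var (Sum.inl 1), by simp⟩
    (equivJ_iff_equivalent.{u, v, u, w'} hL isModelFEA_term).2 h

end Isomorphism

end Query

end QueryLattice

theorem mainTheorem2 (L : FirstOrder.Language.{u, v}) (hL : Nonempty (L.Functions 0)) :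
    (∀ (J : Type w) [(QueryLattice.fnPart L).Structure J],
      Nontrivial J → QueryLattice.IsModelFEA L J →
      ∀ Q Q' : QueryLattice.Query L,
        (QueryLattice.Query.EquivJ J Q Q' ↔
          QueryLattice.Query.Equivalent.{u, v, max u w'} Q Q') ∧
        (QueryLattice.Query.LeJ J Q Q' ↔
          QueryLattice.Query.Le.{u, v, max u w'} Q Q')) ∧
    (∀ Q Q' : QueryLattice.Query L,
      QueryLattice.Query.Equivalent.{u, v, max u w'} Q Q' →
      Q.Solved → Q'.Solved → QueryLattice.Query.Isomorphic Q Q') := by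
  refine ⟨fun J _ _ hJ Q Q' => ⟨?_, ?_⟩, fun Q Q' h hQ hQ' => h.isomorphic.{u, v, w'} hL hQ hQ'⟩
  · exact QueryLattice.Query.equivJ_iff_equivalent.{u, v, w, w'} hL hJ
  · exact QueryLattice.Query.leJ_iff_le.{u, v, w, w'} hL hJ
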